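/- **Setting.** Let $k\ge 1$ and let $\mathcal P=\{p_1,\dots,p_{k^2}\}$ be a family of $k^2$ real polynomials in $2k^2$ commuting variables $x_1,\dots,x_{2k^2}$. An *arrangement* consists of two $k\times k$ matrices $X,Y$ whose entries are the variables $x_j$, each used exactly once, and a $k\times k$ array $\mathbb P$ whose entries are $p_1,\dots,p_{k^2}$, each index used exactly once. An nc polynomial $p$ in two letters (a real linear combination of words) is an *nc representation* of $\mathcal P$, for this arrangement, if $p(X,Y)=\mathbb P$. For an nc polynomial $p$ let $\varphi(i,j)$ be the sum of the coefficients of its words of degree $i$ in $X$ and $j$ in $Y$; let $\varphi(i,j;Z)$ (resp. $\varphi(Z;i,j)$) be the same sum restricted to the words that end (resp. begin) with the letter $Z\in\{X,Y\}$. Let $\mathcal W$ be the set of nc polynomials of degree $d>1$ for which there is an integer $t\ge2$ with $$\varphi(t,0)\ne0,\quad \varphi(0,t)\ne0,\quad \varphi(t,0)\ne\varphi(0,t)$$ and at least one of 1. $t\varphi(t,0)\ne\varphi(t-1,1)$; 2. $t\varphi(0,t)\ne\varphi(1,t-1)$; 3. $\varphi(t-1,1;Y)\ne0$ and $\varphi(t,0)\ne\varphi(t-1,1;Y)$;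 4. $\varphi(Y;t-1,1)\ne0$ and $\varphi(t,0)\ne\varphi(Y;t-1,1)$; 5. $\varphi(1,t-1;X)\ne0$ and $\varphi(0,t)\ne\varphi(1,t-1;X)$; 6. $\varphi(X;1,t-1)\ne0$ and $\varphi(0,t)\ne\varphi(X;1,t-1)$. **The algorithms.** Alg.1 and Alg.2 run through the degrees $n\ge 2$ (up to the largest degree $d$ of a polynomial of $\mathcal P$, in increasing order) and the nonzero coefficients $a$ of the words $x_v^n$ in $\mathcal P$. For each $(n,a)$ they perform the following steps; if a step fails they pass to the next $(n,a)$, and the first success is returned. * *Diagonal.* Check that exactly $k$ or $2k$ words $x_v^n$ occur in $\mathcal P$, with at most two distinct coefficients, and that exactly $k$ of them, in $k$ distinct variables, have coefficient $a$. Let $D$ be the set of these $k$ variables (the diagonal of $X$). * *DiagPar1* (in Alg.1). A variable $x_u\notin D$ is attributed to $X$ if the substitution $x_v=\alpha$ for $x_v\in D$, $x_u=\beta$, all other variables $0$, in the degree $n$ parts of $p_1,\dots,p_{k^2}$ produces $k$ polynomials equal to $a\alpha^n$, one equal to $na\alpha^{n-1}\beta$ and $k^2-k-1$ equal to $0$.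 *DiagPar2* (in Alg.2). A variable $x_u\notin D$ is attributed to $X$ if for some $x_v\in D$ and some $p_q$ that contains no word $x_w^n$, $x_v^{n-1}x_u$ is the only word of the form $x_v^{n-1}x_w$, $w\ne v$, with coefficient $a$ in $p_q$. In both cases let $S$ consist of $D$ and the variables so attributed; the step fails unless $|S|=k^2$. * *ParPosX.* Put the variables of $D$ on the diagonal of $X$, in any order, as $x_{11},\dots,x_{kk}$. Let $L_i$ be the set of $x_u\in S\setminus D$ for which $x_{ii}^{n-1}x_u$ has coefficient $a$ in some $p_q$. Put any one element of $L_1\cap L_2$ in position $(1,2)$ (if $k\ge2$). Then repeat as long as possible: (i) if $x_u$ is placed in $(i,j)$, $i\neq j$, put the elements of $L_i\cap L_j$ other than $x_u$ in $(j,i)$; (ii) if $x_u$ is placed in $(i,r)$, $i\ne r$, if $x_{ii}^{n-1}x_u$ and $x_ux_{rr}^{n-1}$ both have coefficient $a$ in $p_q$, and if for some $h\ne i,r$ a word $x_{ii}^{n-2}x_sx_m$ with $x_s\in L_i\cap L_h$, $x_m\in L_h\cap L_r$ has coefficient $a$ in $p_q$, put $x_s$ in $(i,h)$ and $x_m$ in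 $(h,r)$. The step fails unless every position has received exactly one variable. * *PosPol.* Put in position $(i,j)$ of $\mathbb P$ the polynomial in which $x_{ii}^{n-1}x_{ij}$ has coefficient $a$, where $x_{ij}$ is the $(i,j)$ entry of $X$; fail unless it is unique. * *PosY.* For the pairs of degrees $1\le t\le m\le d$ in turn, take the degree $m$ parts of the polynomials and set $X=I$; let $y_{ii}$ be the unique variable outside $S$ whose power $y_{ii}^t$ occurs in the resulting polynomial in position $(i,i)$, and $y_{ij}$ the unique variable outside $S$ for which $y_{ii}^{t-1}y_{ij}$ occurs in the resulting polynomial in position $(i,j)$. The first pair $(m,t)$ for which all these exist gives $Y$; fail if there is none. * *NcCoef.* Fail unless an arrangement has been obtained (each variable and each polynomial used exactly once). Solve the linear system $p(X,Y)=\mathbb P$ for the coefficients of an nc polynomial $p$ of degree at most $d$; return $X,Y,\mathbb P$ and the solution set, or fail if there is no solution. **Theorem.** Whatever arbitrary choices are made in ParPosX, $\mathcal P$ admits an nc representation $p\in\mathcal W$ if and only if Alg.1 or Alg.2 succeeds with a solution set that contains an element of $\mathcal W$. Whenever Alg.1 or Alg.2 succeeds, every element of the solution set it returns is an nc representation of $\mathcal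 P$ for the arrangement it returns; and if $k\ge2$ and one of these solutions is in $\mathcal W$, then all of them are. Thus the algorithms decide whether $\mathcal P$ has an nc representation in $\mathcal W$ and construct one when there is one. -/

import Mathlib

/-! ## Non-commutative polynomials in two letters -/

/-- Nc polynomials in two letters over `ℝ`: finite linear combinations of words in the letters
`0` (standing for `X`) and `1` (standing for `Y`). -/
abbrev NcPoly : Type := MonoidAlgebra ℝ (FreeMonoid (Fin 2))

namespace NcPoly

/-- Substitution of elements `a`, `b` of an `ℝ`-algebra for the letters `X`, `Y`. -/
noncomputable def eval {R : Type*} [Semiring R] [Algebra ℝ R] (a b : R) : NcPoly →ₐ[ℝ] R :=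
  MonoidAlgebra.lift ℝ R (FreeMonoid (Fin 2)) (FreeMonoid.lift ![a, b])

/-- The degree: the largest length of a word that occurs (`0` for the zero polynomial). -/
def degree (p : NcPoly) : ℕ := p.coeff.support.sup fun w => w.toList.length

/-- `φ(i,j)`: the sum of the coefficients of the words of degree `i` in `X` and `j` in `Y`. -/
noncomputable def phi (p : NcPoly) (i j : ℕ) : ℝ :=
  ∑ w ∈ p.coeff.support with w.toList.count 0 = i ∧ w.toList.count 1 = j, p.coeff w

/-- `φ(i,j;ℓ)`: the sum restricted to the words that end in the letter `ℓ`. -/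
noncomputable def phiEnd (p : NcPoly) (i j : ℕ) (l : Fin 2) : ℝ :=
  ∑ w ∈ p.coeff.support with
    (w.toList.count 0 = i ∧ w.toList.count 1 = j) ∧ w.toList.getLast? = some l, p.coeff w

/-- `φ(ℓ;i,j)`: the sum restricted to the words that begin with the letter `ℓ`. -/
noncomputable def phiStart (p : NcPoly) (l : Fin 2) (i j : ℕ) : ℝ :=
  ∑ w ∈ p.coeff.support with
    (w.toList.count 0 = i ∧ w.toList.count 1 = j) ∧ w.toList.head? = some l, p.coeff w

end NcPoly

/-- The class `𝒲` of nc polynomials. -/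
def classW : Set NcPoly :=
  {p | 1 < p.degree ∧ ∃ t : ℕ, 2 ≤ t ∧
    p.phi t 0 ≠ 0 ∧ p.phi 0 t ≠ 0 ∧ p.phi t 0 ≠ p.phi 0 t ∧
    ( (t : ℝ) * p.phi t 0 ≠ p.phi (t - 1) 1 ∨
      (t : ℝ) * p.phi 0 t ≠ p.phi 1 (t - 1) ∨
      (p.phiEnd (t - 1) 1 1 ≠ 0 ∧ p.phi t 0 ≠ p.phiEnd (t - 1) 1 1) ∨
      (p.phiStart 1 (t - 1) 1 ≠ 0 ∧ p.phi t 0 ≠ p.phiStart 1 (t - 1) 1) ∨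
      (p.phiEnd 1 (t - 1) 0 ≠ 0 ∧ p.phi 0 t ≠ p.phiEnd 1 (t - 1) 0) ∨
      (p.phiStart 0 1 (t - 1) ≠ 0 ∧ p.phi 0 t ≠ p.phiStart 0 1 (t - 1)) )}

/-! ## Families of `k²` polynomials in `2k²` commuting variables, and their nc representations -/

/-- The names of the `2k²` commuting variables. -/
abbrev Var (k : ℕ) : Type := Fin (2 * k ^ 2)

/-- A family of `k²` real polynomials in `2k²` commuting variables. -/
abbrev Family (k : ℕ) : Type := Fin (k ^ 2) → MvPolynomial (Var k) ℝ

/-- A placement of the `2k²` variables in two `k × k` matrices `X`, `Y`, each variable being used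
exactly once, and of the `k²` polynomials in a `k × k` array `L`, each being used exactly once. -/
structure Arrangement (k : ℕ) where
  X : Matrix (Fin k) (Fin k) (Var k)
  Y : Matrix (Fin k) (Fin k) (Var k)
  L : Matrix (Fin k) (Fin k) (Fin (k ^ 2))
  var_bij : Function.Bijective
    (Sum.elim (fun e : Fin k × Fin k => X e.1 e.2) (fun e : Fin k × Fin k => Y e.1 e.2))
  pol_bij : Function.Bijective (fun e : Fin k × Fin k => L e.1 e.2)

/-- `p(X,Y)` equals the array of polynomials. -/
def IsNcRep {k : ℕ} (P : Family k) (A : Arrangement k) (p : NcPoly) : Prop :=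
  NcPoly.eval (A.X.map (MvPolynomial.X (R := ℝ))) (A.Y.map (MvPolynomial.X (R := ℝ))) p = A.L.map P

/-- The family has an nc representation `p(X,Y)` with `p` in the class `C`. -/
def HasNcRepIn {k : ℕ} (P : Family k) (C : Set NcPoly) : Prop :=
  ∃ (A : Arrangement k) (p : NcPoly), IsNcRep P A p ∧ p ∈ C

/-! ## The one letter algorithms -/

namespace OneLetter

open MvPolynomial

/-- The largest degree of a polynomial of the family. -/
def famDegree {k : ℕ} (P : Family k) : ℕ := Finset.univ.sup fun q => (P q).totalDegree

/-- A rule for the arbitrary choices that the algorithms make: in which order a set of `k`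
variables is put on the diagonal, and which element of a nonempty set of variables is taken. -/
structure TieBreak (k : ℕ) where
  order : Finset (Var k) → Fin k → Var k
  order_spec : ∀ D : Finset (Var k), D.card = k → Finset.univ.image (order D) = D
  pick : Finset (Var k) → Var k
  pick_mem : ∀ s : Finset (Var k), s.Nonempty → pick s ∈ s

/-- There is such a rule, so that a statement about all of them is not void. -/
theorem TieBreak.nonempty {k : ℕ} (hk : 0 < k) : Nonempty (TieBreak k) := by
  classical
  have hv : 0 < 2 * k ^ 2 := by positivity
  have h1 : ∀ D : Finset (Var k), ∃ f : Fin k → Var k,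
      D.card = k → Finset.univ.image f = D := by
    intro D
    by_cases h : D.card = k
    · refine ⟨D.orderEmbOfFin h, fun _ => ?_⟩
      simp
    · exact ⟨fun _ => ⟨0, hv⟩, fun h' => absurd h' h⟩
  have h2 : ∀ s : Finset (Var k), ∃ u : Var k, s.Nonempty → u ∈ s := by
    intro s
    by_cases h : s.Nonempty
    · exact ⟨h.choose, fun _ => h.choose_spec⟩
    · exact ⟨⟨0, hv⟩, fun h' => absurd h' h⟩
  choose f hf using h1
  choose g hg using h2
  exact ⟨⟨f, hf, g, hg⟩⟩

/-- The coefficient of the one letter word `x_v ^ n` in the polynomial number `q`. -/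
noncomputable def one {k : ℕ} (P : Family k) (n : ℕ) (q : Fin (k ^ 2)) (v : Var k) : ℝ :=
  coeff (Finsupp.single v n) (P q)

/-- The coefficient of the word `x_v ^ (n-1) * x_u` in the polynomial number `q`. -/
noncomputable def two {k : ℕ} (P : Family k) (n : ℕ) (q : Fin (k ^ 2)) (v u : Var k) : ℝ :=
  coeff (Finsupp.single v (n - 1) + Finsupp.single u 1) (P q)

/-- The coefficient of the word `x_v ^ (n-2) * x_u * x_w` in the polynomial number `q`. -/
noncomputable def three {k : ℕ} (P : Family k) (n : ℕ) (q : Fin (k ^ 2)) (v u w : Var k) : ℝ :=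
  coeff (Finsupp.single v (n - 2) + Finsupp.single u 1 + Finsupp.single w 1) (P q)

open scoped Classical in
/-- The nonzero coefficients of one letter words of degree `n` in the family. -/
noncomputable def oneCoeffs {k : ℕ} (P : Family k) (n : ℕ) : Finset ℝ :=
  (Finset.univ.image fun e : Fin (k ^ 2) × Var k => one P n e.1 e.2).erase 0

open scoped Classical in
/-- The variables `x_v` for which `a * x_v ^ n` occurs in the family. -/
noncomputable def diagVars {k : ℕ} (P : Family k) (n : ℕ) (a : ℝ) : Finset (Var k) :=
  {v | ∃ q, one P n q v = a}

open scoped Classical in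
/-- The diagonal test: there are exactly `k` or `2k` one letter words of degree `n` in the family,
with at most two distinct coefficients, and exactly `k` of them, in `k` distinct variables, have
the coefficient `a`. -/
def DiagOK {k : ℕ} (P : Family k) (n : ℕ) (a : ℝ) : Prop :=
  a ≠ 0 ∧ (oneCoeffs P n).card ≤ 2 ∧
  (let N := Finset.card {e : Fin (k ^ 2) × Var k | one P n e.1 e.2 ≠ 0}
   N = k ∨ N = 2 * k) ∧
  Finset.card {e : Fin (k ^ 2) × Var k | one P n e.1 e.2 = a} = k ∧
  (diagVars P n a).card = k

open scoped Classical in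
/-- The value of the degree `n` part of the polynomial number `q` when the variables in `D` are set
equal to `α`, the variable `x_u` to `β`, and all others to `0`, as a polynomial in the
indeterminates `α = X 0` and `β = X 1`. -/
noncomputable def probe {k : ℕ} (P : Family k) (n : ℕ) (D : Finset (Var k)) (u : Var k)
    (q : Fin (k ^ 2)) : MvPolynomial (Fin 2) ℝ :=
  aeval (fun v => if v ∈ D then X 0 else if v = u then X 1 else 0) (homogeneousComponent n (P q))

open scoped Classical in
/-- The test of DiagPar1 for off-diagonal entries of `X`: the substitution produces `k` polynomials
equal to `a α^n`, one equal to `n a α^(n-1) β`, and `k² - k - 1` equal to `0`. -/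
def Par1Test {k : ℕ} (P : Family k) (n : ℕ) (a : ℝ) (D : Finset (Var k)) (u : Var k) : Prop :=
  Finset.card {q | probe P n D u q = C a * X 0 ^ n} = k ∧
  Finset.card {q | probe P n D u q = C (n * a) * X 0 ^ (n - 1) * X 1} = 1 ∧
  Finset.card {q | probe P n D u q = 0} + k + 1 = k ^ 2

open scoped Classical in
/-- The test of DiagPar2 for off-diagonal entries of `X`: for some diagonal variable `x_v` of `X`
and some off-diagonal polynomial (one without one letter words of degree `n`), the word
`x_v ^ (n-1) * x_u` is the only word `x_v ^ (n-1) * x_w`, `w ≠ v`, that has the coefficient `a`. -/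
def Par2Test {k : ℕ} (P : Family k) (n : ℕ) (a : ℝ) (D : Finset (Var k)) (u : Var k) : Prop :=
  ∃ v ∈ D, ∃ q, (∀ w, one P n q w = 0) ∧ ∀ w, (w ≠ v ∧ two P n q v w = a) ↔ w = u

open scoped Classical in
/-- The variables attributed to `X`: the diagonal ones, and those that pass the test. The step
fails unless these are `k²` variables; the others are then attributed to `Y`. -/
noncomputable def partition {k : ℕ} (D : Finset (Var k)) (Test : Var k → Prop) :
    Option (Finset (Var k)) :=
  let S := D ∪ ({u | u ∉ D ∧ Test u} : Finset (Var k))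
  if S.card = k ^ 2 then some S else none

open scoped Classical in
/-- Fill a table, each of whose entries has to be determined uniquely by the given criterion. -/
noncomputable def fill {ι α : Type*} (R : ι → α → Prop) : Option (ι → α) :=
  if h : ∀ i, ∃! u, R i u then some fun i => (h i).choose else none

open scoped Classical in
/-- The list `L(x_v)` of the off-diagonal variables `x_u` of `X` for which `a * x_v^(n-1) * x_u`
occurs in the family. -/
noncomputable def rowCol {k : ℕ} (P : Family k) (n : ℕ) (a : ℝ) (D S : Finset (Var k))
    (v : Var k) : Finset (Var k) :=
  {u | u ∈ S ∧ u ∉ D ∧ ∃ q, two P n q v u = a}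

/-- The placements in `X` made by ParPosX, where `δ i` is the chosen `i`-th diagonal entry.
`Placed … u i j` says that `x_u` is put in the `(i,j)` position. -/
inductive Placed {k : ℕ} (c : TieBreak k) (P : Family k) (n : ℕ) (a : ℝ) (D S : Finset (Var k))
    (δ : Fin k → Var k) : Var k → Fin k → Fin k → Prop
  /-- The diagonal entries. -/
  | diag (i : Fin k) : Placed c P n a D S δ (δ i) i i
  /-- One variable common to the first two lists is put in the first row and second column. -/
  | seed (i j : Fin k) (hi : i.val = 0) (hj : j.val = 1)
      (h : (rowCol P n a D S (δ i) ∩ rowCol P n a D S (δ j)).Nonempty) :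
      Placed c P n a D S δ (c.pick (rowCol P n a D S (δ i) ∩ rowCol P n a D S (δ j))) i j
  /-- Of the two variables common to the `i`-th and the `j`-th list, one is in the `(i,j)` position
  and the other in the `(j,i)` position. -/
  | swap (i j : Fin k) (u w : Var k) (hij : i ≠ j) (hu : Placed c P n a D S δ u i j)
      (hw : w ∈ rowCol P n a D S (δ i) ∩ rowCol P n a D S (δ j)) (hwu : w ≠ u) :
      Placed c P n a D S δ w j i
  /-- If `x_u` is in the `(i,r)` position, then the polynomial that contains
  `a * x_{δ i}^(n-1) * x_u` and `a * x_u * x_{δ r}^(n-1)` is in the `(i,r)` position, and a word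
  `a * x_{δ i}^(n-2) * x_s * x_m` in it, with `x_s` in the `i`-th and `h`-th lists and `x_m` in the
  `h`-th and `r`-th lists, puts `x_s` in the `(i,h)` and `x_m` in the `(h,r)` position. -/
  | row (i r h : Fin k) (u s m : Var k) (q : Fin (k ^ 2)) (hir : i ≠ r) (hhi : h ≠ i) (hhr : h ≠ r)
      (hu : Placed c P n a D S δ u i r)
      (hq : two P n q (δ i) u = a) (hq' : two P n q (δ r) u = a)
      (hs : s ∈ rowCol P n a D S (δ i) ∩ rowCol P n a D S (δ h))
      (hm : m ∈ rowCol P n a D S (δ h) ∩ rowCol P n a D S (δ r))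
      (h3 : three P n q (δ i) s m = a) :
      Placed c P n a D S δ s i h
  /-- The second half of the preceding rule. -/
  | col (i r h : Fin k) (u s m : Var k) (q : Fin (k ^ 2)) (hir : i ≠ r) (hhi : h ≠ i) (hhr : h ≠ r)
      (hu : Placed c P n a D S δ u i r)
      (hq : two P n q (δ i) u = a) (hq' : two P n q (δ r) u = a)
      (hs : s ∈ rowCol P n a D S (δ i) ∩ rowCol P n a D S (δ h))
      (hm : m ∈ rowCol P n a D S (δ h) ∩ rowCol P n a D S (δ r))
      (h3 : three P n q (δ i) s m = a) :
      Placed c P n a D S δ m h r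

/-- Algorithm ParPosX: positions the variables of `X`. -/
noncomputable def parPosX {k : ℕ} (c : TieBreak k) (P : Family k) (n : ℕ) (a : ℝ)
    (D S : Finset (Var k)) : Option (Fin k × Fin k → Var k) :=
  fill fun e u => Placed c P n a D S (c.order D) u e.1 e.2

/-- Algorithm PosPol: the polynomial in the `(i,j)` position is the one that contains
`a * x_{ii}^(n-1) * x_{ij}`, where `x_{ij}` are the entries of `X`. -/
noncomputable def posPol {k : ℕ} (P : Family k) (n : ℕ) (a : ℝ) (x : Fin k × Fin k → Var k) :
    Option (Fin k × Fin k → Fin (k ^ 2)) :=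
  fill fun e q => two P n q (x (e.1, e.1)) (x e) = a

open scoped Classical in
/-- The degree `m` part of the polynomial number `q` after the substitution `X = I`. -/
noncomputable def specialize {k : ℕ} (P : Family k) (D S : Finset (Var k)) (m : ℕ)
    (q : Fin (k ^ 2)) : MvPolynomial (Var k) ℝ :=
  aeval (fun v => if v ∈ S then (if v ∈ D then 1 else 0) else X v) (homogeneousComponent m (P q))

/-- Algorithm PosY, run with the words `x_y ^ t` of the degree `m` parts. First the diagonal of `Y`
is read off from the words `x_y ^ t` in the diagonal polynomials (after `X = I`), then the entry in
the `(i,j)` position from the words `x_{y_ii} ^ (t-1) * x_u` in the polynomial in that position. -/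
noncomputable def posYAt {k : ℕ} (P : Family k) (D S : Finset (Var k))
    (lam : Fin k × Fin k → Fin (k ^ 2)) (m t : ℕ) : Option (Fin k × Fin k → Var k) :=
  (fill fun (i : Fin k) (u : Var k) =>
    u ∉ S ∧ coeff (Finsupp.single u t) (specialize P D S m (lam (i, i))) ≠ 0).bind fun y =>
  fill fun (e : Fin k × Fin k) (u : Var k) =>
    u ∉ S ∧ coeff (Finsupp.single (y e.1) (t - 1) + Finsupp.single u 1)
      (specialize P D S m (lam e)) ≠ 0

/-- Algorithm PosY: the first pair `1 ≤ t ≤ m` for which the positioning succeeds is used. -/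
noncomputable def posY {k : ℕ} (P : Family k) (D S : Finset (Var k))
    (lam : Fin k × Fin k → Fin (k ^ 2)) : Option (Fin k × Fin k → Var k) :=
  (List.range (famDegree P + 1)).findSome? fun m =>
    (List.range m).findSome? fun t => posYAt P D S lam m (t + 1)

open scoped Classical in
/-- Algorithm NcCoef: solves the linear system `p(X,Y) = ℙ` for the coefficients of an nc
polynomial `p` of degree at most that of the family. It returns the solution set, and fails if
there is no solution. -/
noncomputable def ncCoef {k : ℕ} (P : Family k) (A : Arrangement k) : Option (Set NcPoly) :=
  let Sol : Set NcPoly := {p | p.degree ≤ famDegree P ∧ IsNcRep P A p}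
  if Sol.Nonempty then some Sol else none

open scoped Classical in
/-- The steps ParPosX, PosPol, PosY, NcCoef, performed one after the other on the set `D` of
diagonal variables of `X` and the set `S` of all variables of `X`; a failure of one step is a
failure of the whole. Placements that use a variable or a polynomial twice are rejected. -/
noncomputable def afterPartition {k : ℕ} (c : TieBreak k) (P : Family k) (n : ℕ) (a : ℝ)
    (D S : Finset (Var k)) : Option (Arrangement k × Set NcPoly) :=
  (parPosX c P n a D S).bind fun x =>
  (posPol P n a x).bind fun lam =>
  (posY P D S lam).bind fun y =>
  if h : Function.Bijective (Sum.elim x y) ∧ Function.Bijective lam then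
    let A : Arrangement k :=
      { X := fun i j => x (i, j), Y := fun i j => y (i, j), L := fun i j => lam (i, j)
        var_bij := h.1, pol_bij := h.2 }
    (ncCoef P A).map fun Sol => (A, Sol)
  else none

open scoped Classical in
/-- The common frame of the two algorithms: for each degree `n ≥ 2` in increasing order and each
coefficient `a` of a one letter word of degree `n` that passes the diagonal test, put the
variables of these words on the diagonal of `X`, partition, and perform the remaining steps. The
first success is returned. -/
noncomputable def run {k : ℕ}
    (Test : Family k → ℕ → ℝ → Finset (Var k) → Var k → Prop) (c : TieBreak k)
    (P : Family k) : Option (Arrangement k × Set NcPoly) :=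
  (List.range (famDegree P + 1)).findSome? fun n =>
    (oneCoeffs P n).toList.findSome? fun a =>
      if 2 ≤ n ∧ DiagOK P n a then
        (partition (diagVars P n a) (Test P n a (diagVars P n a))).bind fun S =>
          afterPartition c P n a (diagVars P n a) S
      else none

/-- Alg.1: the steps DiagPar1, ParPosX, PosPol, PosY, NcCoef. -/
noncomputable def alg1 {k : ℕ} (c : TieBreak k) (P : Family k) :
    Option (Arrangement k × Set NcPoly) := run Par1Test c P

/-- Alg.2: the steps DiagPar2, ParPosX, PosPol, PosY, NcCoef. -/
noncomputable def alg2 {k : ℕ} (c : TieBreak k) (P : Family k) :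
    Option (Arrangement k × Set NcPoly) := run Par2Test c P

end OneLetter

/-! An entry `(r,s)` of a word in two generic matrices is a sum over walks from `r` to `s`, each
edge carrying its own variable. If a monomial consists almost entirely of one loop variable `x_ii`,
there is hardly any choice for the walk, so at most one word produces it. Hence the coefficients
that the algorithms inspect are single coefficients of `p`: `x_ii^n` shows `φ(n,0)`, and `x_ii^(n-1)
x_ab` and `x_ii^(n-2) x_ih x_hr` reveal rows, columns and products of entries. This is
`wordCoeff_pow`, `wordCoeff_two_offdiag`, `wordCoeff_two_diag` and `wordCoeff_three`.

A pair `(n,a)` that passes the diagonal test isolates the diagonal of one of the two matrices; call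
it `X`, interchanging the letters if necessary. Each partition test is reliable on one side without
any separation hypothesis: DiagPar1 accepts every off-diagonal entry of `X`, and DiagPar2 rejects
every entry of `Y`. Together with the demand for exactly `k²` variables, this makes every completed
partition correct (`partition_eq_xSet`), even at a degree `n` unrelated to the `t` that witnesses
membership in `𝒲`. At `t` itself, conditions 1 and 2 make DiagPar1 correct on the other side, and
conditions 3 to 6 do this for DiagPar2; so one of the algorithms succeeds.

The free choices in ParPosX amount to a simultaneous permutation of rows and columns and a
transposition, which turn `p` into itself or into its reversal (`exists_normalized`). After this
normalization the positioning steps recover the arrangement exactly. For `Y`, the substitution `X =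
I` collapses the words with `t` letters `Y` in degree `m` to `φ(m-t,t) Y^t`. Finally, NcCoef finds
the truncation of the normalized `p`, which is still in `𝒲`. For `k ≥ 2` all quantities in the
definition of `𝒲` can be read off from the family and the arrangement, so one solution in `𝒲` forces
all of them to be there. -/

/-! ## Words in two generic matrices -/

section Words

variable {ι V : Type*}

/-- Different letters and positions carry different variables. -/
def Generic (z : Fin 2 → ι → ι → V) : Prop :=
  ∀ l i j l' i' j', z l i j = z l' i' j' → l = l' ∧ i = i' ∧ j = j'

theorem Generic.eq_iff {z : Fin 2 → ι → ι → V} (hz : Generic z) {l i j l' i' j'} :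
    z l i j = z l' i' j' ↔ l = l' ∧ i = i' ∧ j = j' :=
  ⟨hz _ _ _ _ _ _, by rintro ⟨rfl, rfl, rfl⟩; rfl⟩

variable [Fintype ι] [DecidableEq ι]

/-- The generic matrix whose entries are the variables that `z` assigns to the letter `l`. -/
noncomputable def letterMat (z : Fin 2 → ι → ι → V) (l : Fin 2) :
    Matrix ι ι (MvPolynomial V ℝ) :=
  Matrix.of fun i j => MvPolynomial.X (z l i j)

/-- The value of a word at the generic matrices. -/
noncomputable def wordMat (z : Fin 2 → ι → ι → V) (w : List (Fin 2)) :
    Matrix ι ι (MvPolynomial V ℝ) :=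
  (w.map (letterMat z)).prod

/-- The coefficient of the monomial `m` in an entry of the value of a word. -/
noncomputable def wordCoeff (z : Fin 2 → ι → ι → V) (w : List (Fin 2)) (r s : ι) (m : V →₀ ℕ) : ℝ :=
  MvPolynomial.coeff m (wordMat z w r s)

variable {z : Fin 2 → ι → ι → V}

theorem wordMat_nil : wordMat z [] = 1 := by simp [wordMat]

theorem wordMat_cons (l : Fin 2) (w : List (Fin 2)) :
    wordMat z (l :: w) = letterMat z l * wordMat z w := by simp [wordMat]

variable [DecidableEq V]

theorem wordCoeff_nil (r s : ι) (m : V →₀ ℕ) :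
    wordCoeff z [] r s m = if r = s ∧ m = 0 then 1 else 0 := by
  by_cases h : r = s
  · subst h
    simp [wordCoeff, wordMat_nil, MvPolynomial.coeff_one, eq_comm]
  · simp [wordCoeff, wordMat_nil, Matrix.one_apply_ne h, h]

/-- `wordCoeff z w r s m` counts the walks from `r` to `s` labelled by `w` whose edge variables
multiply to `m`. The recursion removes the first edge; the support condition guards the truncated
subtraction of exponents. -/
theorem wordCoeff_cons (l : Fin 2) (w : List (Fin 2)) (r s : ι) (m : V →₀ ℕ) :
    wordCoeff z (l :: w) r s m =
      ∑ j, if z l r j ∈ m.support then wordCoeff z w j s (m - Finsupp.single (z l r j) 1) else 0 := by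
  simp only [wordCoeff, wordMat_cons, Matrix.mul_apply, MvPolynomial.coeff_sum, letterMat,
    Matrix.of_apply, MvPolynomial.coeff_X_mul']

/-- Only the edges that occur in the monomial contribute to the first step of a walk. -/
theorem wordCoeff_cons_eq (T : Finset ι) (l : Fin 2) (w : List (Fin 2)) (r s : ι) (m : V →₀ ℕ)
    (f : ι → V →₀ ℕ) (hf : ∀ j ∈ T, m = f j + Finsupp.single (z l r j) 1)
    (hT : ∀ j, j ∉ T → m (z l r j) = 0) :
    wordCoeff z (l :: w) r s m = ∑ j ∈ T, wordCoeff z w j s (f j) := by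
  rw [wordCoeff_cons, ← Finset.sum_subset (Finset.subset_univ T)]
  · refine Finset.sum_congr rfl fun j hj => ?_
    have h := hf j hj
    rw [if_pos (by rw [Finsupp.mem_support_iff, h]; simp), h, add_tsub_cancel_right]
  · intro j _ hj
    rw [if_neg (by simpa using hT j hj)]

/-- Only the loop at `i` is available, so the walk stays at `i`. For `N = 0` the walk is empty and
may sit at any vertex. -/
theorem wordCoeff_pow (hz : Generic z) (l : Fin 2) (i : ι) (w : List (Fin 2)) (N : ℕ) (r s : ι) :
    wordCoeff z w r s (Finsupp.single (z l i i) N) =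
      if r = s ∧ w = List.replicate N l ∧ (N = 0 ∨ r = i) then 1 else 0 := by
  induction w generalizing N r with
  | nil =>
    rw [wordCoeff_nil]
    congr 1
    rcases N with _ | N <;> simp [List.replicate_succ]
  | cons l' w ih =>
    rcases N with _ | N
    · rw [wordCoeff_cons_eq ∅ l' w r s _ (fun _ => 0) (by simp) (by simp)]
      simp
    · by_cases h : l' = l ∧ r = i
      · obtain ⟨rfl, rfl⟩ := h
        rw [wordCoeff_cons_eq {r} l' w r s _ (fun _ => Finsupp.single (z l' r r) N)]
        · rw [Finset.sum_singleton, ih]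
          simp [List.replicate_succ]
        · intro j hj
          rw [Finset.mem_singleton.1 hj, Finsupp.single_add]
        · intro j hj
          rw [Finsupp.single_apply, if_neg]
          rw [hz.eq_iff]
          rintro ⟨_, _, rfl⟩
          simp at hj
      · rw [wordCoeff_cons_eq ∅ l' w r s _ (fun _ => 0) (by simp)]
        · rw [Finset.sum_empty, if_neg]
          rintro ⟨_, h1, h2⟩
          simp only [List.replicate_succ, List.cons.injEq] at h1
          exact h ⟨h1.1, by simpa using h2⟩
        · intro j _
          rw [Finsupp.single_apply, if_neg]
          rw [hz.eq_iff]
          rintro ⟨rfl, rfl, _⟩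
          simp at h

/-- After the edge `a → b` the walk stands at `b ≠ a` and cannot use the same edge again. -/
theorem wordCoeff_pow_offdiag (hz : Generic z) (l : Fin 2) {a b : ι} (hab : a ≠ b)
    (w : List (Fin 2)) {N : ℕ} (hN : 2 ≤ N) (r s : ι) :
    wordCoeff z w r s (Finsupp.single (z l a b) N) = 0 := by
  obtain ⟨N, rfl⟩ := Nat.exists_eq_add_of_le' hN
  have key : ∀ (w : List (Fin 2)) (M : ℕ) (r : ι), r ≠ a →
      wordCoeff z w r s (Finsupp.single (z l a b) (M + 1)) = 0 := by
    intro w M r hr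
    cases w with
    | nil => simp [wordCoeff_nil]
    | cons l' w =>
      rw [wordCoeff_cons_eq ∅ l' w r s _ (fun _ => 0) (by simp), Finset.sum_empty]
      intro j _
      rw [Finsupp.single_apply, if_neg]
      rw [hz.eq_iff]
      rintro ⟨_, h, _⟩
      exact hr h.symm
  by_cases hr : r = a
  · subst hr
    cases w with
    | nil => simp [wordCoeff_nil]
    | cons l' w =>
      by_cases hl : l' = l
      · subst hl
        rw [wordCoeff_cons_eq {b} l' w r s _ (fun _ => Finsupp.single (z l' r b) (N + 1)),
          Finset.sum_singleton]
        · exact key w N b hab.symm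
        · intro j hj
          rw [Finset.mem_singleton.1 hj, ← Finsupp.single_add]
        · intro j hj
          rw [Finsupp.single_apply, if_neg]
          rw [hz.eq_iff]
          rintro ⟨_, _, rfl⟩
          simp at hj
      · rw [wordCoeff_cons_eq ∅ l' w r s _ (fun _ => 0) (by simp), Finset.sum_empty]
        intro j _
        rw [Finsupp.single_apply, if_neg]
        rw [hz.eq_iff]
        rintro ⟨h, _⟩
        exact hl h.symm
  · exact key w (N + 1) r hr

/-- The recursion for monomials `v ^ N * u`, where `v` is a diagonal variable. -/
theorem wordCoeff_cons_two (hz : Generic z) (l l' l₀ : Fin 2) (i a b : ι)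
    (huv : ¬ (l = l' ∧ i = a ∧ i = b)) (w : List (Fin 2)) (N : ℕ) (r s : ι) :
    wordCoeff z (l₀ :: w) r s (Finsupp.single (z l i i) N + Finsupp.single (z l' a b) 1) =
      (if r = i ∧ l₀ = l ∧ N ≠ 0 then
        wordCoeff z w i s (Finsupp.single (z l i i) (N - 1) + Finsupp.single (z l' a b) 1) else 0) +
      (if r = a ∧ l₀ = l' then wordCoeff z w b s (Finsupp.single (z l i i) N) else 0) := by
  rw [wordCoeff_cons]
  have hne : z l i i ≠ z l' a b := fun h => huv (hz.eq_iff.1 h)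
  -- The two variables are distinct, so for each `j` at most one of the two summands on the right is
  -- active.
  have hj : ∀ j, (if z l₀ r j ∈ (Finsupp.single (z l i i) N + Finsupp.single (z l' a b) 1).support
      then wordCoeff z w j s (Finsupp.single (z l i i) N + Finsupp.single (z l' a b) 1 -
        Finsupp.single (z l₀ r j) 1) else 0) =
      (if j = i then (if r = i ∧ l₀ = l ∧ N ≠ 0 then
        wordCoeff z w i s (Finsupp.single (z l i i) (N - 1) + Finsupp.single (z l' a b) 1)
          else 0) else 0) +
      (if j = b then (if r = a ∧ l₀ = l' then wordCoeff z w b s (Finsupp.single (z l i i) N)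
        else 0) else 0) := by
    intro j
    by_cases h1 : z l₀ r j = z l i i
    · have h2 : z l₀ r j ≠ z l' a b := h1 ▸ hne
      obtain ⟨rfl, rfl, rfl⟩ := hz.eq_iff.1 h1
      have h3 : ¬ (j = b ∧ j = a ∧ l₀ = l') := fun h => huv ⟨h.2.2, h.2.1, h.1⟩
      have h4 : (if j = b then (if j = a ∧ l₀ = l' then
          wordCoeff z w b s (Finsupp.single (z l₀ j j) N) else 0) else 0) = 0 := by
        split_ifs <;> simp_all
      rw [h4]
      rcases N with _ | N
      · simpa using fun h => absurd h h2
      · simp only [add_zero, if_true, true_and, ne_eq, Nat.add_eq_zero_iff, one_ne_zero, and_false,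
          not_false_eq_true, add_tsub_cancel_right]
        rw [if_pos (by simp)]
        congr 1
        rw [Finsupp.single_add, add_assoc, add_comm (Finsupp.single (z l₀ j j) 1), ← add_assoc,
          add_tsub_cancel_right]
    · have h4 : (if j = i then (if r = i ∧ l₀ = l ∧ N ≠ 0 then
        wordCoeff z w i s (Finsupp.single (z l i i) (N - 1) + Finsupp.single (z l' a b) 1)
          else 0) else 0) = 0 := by
        split_ifs with h5 h6
        · exact absurd (hz.eq_iff.2 ⟨h6.2.1, h6.1, h5⟩) h1
        · rfl
        · rfl
      rw [h4, zero_add]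
      by_cases h2 : z l₀ r j = z l' a b
      · obtain ⟨rfl, rfl, rfl⟩ := hz.eq_iff.1 h2
        rw [if_pos (by simp), add_tsub_cancel_right]
        simp
      · rw [if_neg (by simp [Ne.symm h1, Ne.symm h2])]
        split_ifs with h5 h6
        · exact absurd (hz.eq_iff.2 ⟨h6.2, h6.1, h5⟩) h2
        · rfl
        · rfl
  rw [Finset.sum_congr rfl fun j _ => hj j, Finset.sum_add_distrib]
  simp

/-- The edge `a → b` is used once, so the loops at `i` all come before it (`i = a`) or all after it
(`i = b`). The case `N = 0` is assigned to the first alternative only, which keeps the two disjoint.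
-/
theorem wordCoeff_two_offdiag (hz : Generic z) (l l' : Fin 2) (i : ι) {a b : ι} (hab : a ≠ b)
    (w : List (Fin 2)) (N : ℕ) (r s : ι) :
    wordCoeff z w r s (Finsupp.single (z l i i) N + Finsupp.single (z l' a b) 1) =
      if r = a ∧ s = b ∧ ((N = 0 ∨ i = a) ∧ w = List.replicate N l ++ [l'] ∨
        (N ≠ 0 ∧ i = b) ∧ w = l' :: List.replicate N l) then 1 else 0 := by
  induction w generalizing N r with
  | nil =>
    rw [wordCoeff_nil, if_neg, if_neg]
    · simp
    · simp
  | cons l₀ w ih =>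
    rw [wordCoeff_cons_two hz _ _ _ _ _ _ (fun h => hab (h.2.1.symm.trans h.2.2)),
      wordCoeff_pow hz, ih]
    rcases N with _ | N
    · simp only [ne_eq, not_true_eq_false, and_false, if_false, zero_add, List.replicate_zero]
      by_cases h1 : r = a <;> by_cases h2 : s = b <;> simp [h1, h2, eq_comm (a := b)]
      rw [← ite_and]
    · by_cases hi : i = a
      · subst hi
        by_cases h1 : r = i <;> by_cases h2 : s = b <;>
          simp [h1, h2, List.replicate_succ, hab, hab.symm, eq_comm (a := b)]
        rw [← ite_and]
      · by_cases h1 : r = a <;> by_cases h2 : s = b <;>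
          simp [h1, h2, List.replicate_succ, hi, eq_comm (a := b), eq_comm (a := a)]
        rw [← ite_and]
        congr 1
        simp only [eq_iff_iff]
        tauto

/-- A walk along loops never leaves its starting vertex, so it is closed and cannot use loops at two
different vertices. -/
theorem wordCoeff_two_diag (hz : Generic z) (l l' : Fin 2) (i a : ι) (huv : ¬ (l = l' ∧ i = a))
    (w : List (Fin 2)) (N : ℕ) (r s : ι) (h : r ≠ s ∨ i ≠ a ∧ N ≠ 0) :
    wordCoeff z w r s (Finsupp.single (z l i i) N + Finsupp.single (z l' a a) 1) = 0 := by
  induction w generalizing N r with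
  | nil => rw [wordCoeff_nil, if_neg]; simp
  | cons l₀ w ih =>
    rw [wordCoeff_cons_two hz _ _ _ _ _ _ (fun h => huv ⟨h.1, h.2.1⟩), wordCoeff_pow hz]
    rw [ite_eq_right_iff.2, ite_eq_right_iff.2, add_zero]
    · rintro ⟨rfl, rfl⟩
      rw [if_neg]
      rintro ⟨rfl, _, h2⟩
      rcases h with h | h
      · exact h rfl
      · exact h2.elim h.2 (fun h3 => h.1 h3.symm)
    · rintro ⟨rfl, rfl, hN⟩
      rcases N with _ | N
      · simp at hN
      rw [Nat.add_sub_cancel]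
      by_cases hrs : r = s
      · rcases h with h | h
        · exact absurd hrs h
        -- When the last loop at `i` has been removed, the induction hypothesis no longer applies in
        -- this case; what is left is a single loop variable at `a`.
        rcases N with _ | N
        · have : Finsupp.single (z l₀ r r) 0 + Finsupp.single (z l' a a) 1 =
            Finsupp.single (z l' a a) 1 := by simp
          rw [this, wordCoeff_pow hz, if_neg]
          rintro ⟨_, _, h3⟩
          exact h3.elim (by simp) h.1
        · exact ih _ _ (Or.inr ⟨h.1, by simp⟩)
      · exact ih _ _ (Or.inl hrs)

/-- The monomials `v ^ N * x * y` that occur in the rule of ParPosX: the walk has to be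
`i → ⋯ → i → h → r`. -/
theorem wordCoeff_three (hz : Generic z) (l : Fin 2) {i h r : ι} (hir : i ≠ r) (hhi : h ≠ i)
    (hhr : h ≠ r) (w : List (Fin 2)) (N : ℕ) (f g : Bool) :
    wordCoeff z w i r (Finsupp.single (z l i i) N +
      Finsupp.single (if f then z l i h else z l h i) 1 +
      Finsupp.single (if g then z l h r else z l r h) 1) =
      if f ∧ g ∧ w = List.replicate (N + 2) l then 1 else 0 := by
  induction w generalizing N with
  | nil => rw [wordCoeff_nil, if_neg, if_neg] <;> simp
  | cons l₀ w ih =>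
    -- From `h` the vertex `i` is out of reach: any remaining loop at `i` gives zero, and only the
    -- edge `h → r` can finish the walk.
    have hy : wordCoeff z w h r (Finsupp.single (z l i i) N +
        Finsupp.single (if g then z l h r else z l r h) 1) =
        if g ∧ N = 0 ∧ w = [l] then 1 else 0 := by
      cases g
      · simp [wordCoeff_two_offdiag hz l l i hhr.symm, hhr]
      · simp only [if_true, wordCoeff_two_offdiag hz l l i hhr, true_and, hhi.symm, or_false,
          hir, and_false, false_and]
        congr 1
        simp only [eq_iff_iff]
        exact and_congr_right fun h => by subst h; simp
    -- The edges out of `i` in the monomial are the loop and, if `f` holds, `i → h`; these are the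
    -- only possible first steps.
    have hm : ∀ j, (Finsupp.single (z l i i) N +
        Finsupp.single (if f then z l i h else z l h i) 1 +
        Finsupp.single (if g then z l h r else z l r h) 1 : V →₀ ℕ) (z l₀ i j) =
        (if l₀ = l ∧ j = i then N else 0) + (if f ∧ l₀ = l ∧ j = h then 1 else 0) := by
      intro j
      have h1 : ∀ a b, (z l a b = z l₀ i j) ↔ l₀ = l ∧ i = a ∧ j = b := fun a b => by
        rw [eq_comm, hz.eq_iff]
      cases f <;> cases g <;>
        simp [Finsupp.single_apply, h1, hhi.symm, hir]
    have hv : ∀ M (A B : V →₀ ℕ), Finsupp.single (z l i i) (M + 1) + A + B =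
        Finsupp.single (z l i i) M + A + B + Finsupp.single (z l i i) 1 := by
      intro M A B
      rw [Finsupp.single_add]
      abel
    by_cases hl : l₀ = l
    · subst hl
      cases f
      · rcases N with _ | N
        · rw [wordCoeff_cons_eq ∅ _ _ _ _ _ (fun _ => 0) (by simp) (by intro j _; rw [hm]; simp)]
          simp
        · rw [wordCoeff_cons_eq {i} _ _ _ _ _ (fun _ => _)
            (by intro j hj; rw [Finset.mem_singleton.1 hj]; exact hv _ _ _)
            (by intro j hj; rw [hm]; simpa using hj), Finset.sum_singleton, ih]
          simp
      · rcases N with _ | N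
        · rw [wordCoeff_cons_eq {h} _ _ _ _ _ (fun _ => Finsupp.single (z l₀ i i) 0 +
              Finsupp.single (if g then z l₀ h r else z l₀ r h) 1)
            (by intro j hj; rw [Finset.mem_singleton.1 hj, if_pos rfl, add_right_comm])
            (by intro j hj; rw [hm]; simpa using hj), Finset.sum_singleton, hy]
          simp [List.replicate_succ]
        · rw [wordCoeff_cons_eq {i, h} _ _ _ _ _ (fun j => if j = i then
                Finsupp.single (z l₀ i i) N +
                Finsupp.single (if (true : Bool) = true then z l₀ i h else z l₀ h i) 1 +
                Finsupp.single (if g then z l₀ h r else z l₀ r h) 1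
              else Finsupp.single (z l₀ i i) (N + 1) +
                Finsupp.single (if g then z l₀ h r else z l₀ r h) 1)
            (by
              intro j hj
              rcases Finset.mem_insert.1 hj with rfl | hj
              · simp only [↓reduceIte]; exact hv _ _ _
              · rw [Finset.mem_singleton.1 hj, if_neg hhi, if_pos rfl, add_right_comm])
            (by intro j hj; rw [hm]; simpa using hj), Finset.sum_pair hhi.symm, if_pos rfl,
            if_neg hhi, hy, ih]
          simp [List.replicate_succ]
    · rw [wordCoeff_cons_eq ∅ _ _ _ _ _ (fun _ => 0) (by simp) (by intro j _; rw [hm]; simp [hl])]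
      simp [List.replicate_succ, hl]

end Words

namespace NcPoly

/-! ## Sums over words -/

theorem eval_eq_sum {R : Type*} [Semiring R] [Algebra ℝ R] (a b : R) (p : NcPoly) :
    p.eval a b = p.coeff.sum fun w x => x • (w.toList.map ![a, b]).prod := by
  rw [eval, MonoidAlgebra.lift_apply]
  simp only [FreeMonoid.lift_apply]

theorem map_eval {R S : Type*} [Semiring R] [Algebra ℝ R] [Semiring S] [Algebra ℝ S]
    (f : R →ₐ[ℝ] S) (a b : R) (p : NcPoly) : f (p.eval a b) = p.eval (f a) (f b) := by
  have h : f ∘ ![a, b] = ![f a, f b] := by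
    funext l; fin_cases l <;> simp
  rw [eval_eq_sum, eval_eq_sum, map_finsuppSum]
  simp only [map_smul, map_list_prod, List.map_map, h]

theorem eval_apply {ι R : Type*} [Fintype ι] [DecidableEq ι] [CommSemiring R] [Algebra ℝ R]
    (A B : Matrix ι ι R) (p : NcPoly) (r s : ι) :
    p.eval A B r s = p.coeff.sum fun w x => x • (w.toList.map ![A, B]).prod r s := by
  rw [eval_eq_sum, Finsupp.sum, Matrix.sum_apply]
  rfl

theorem sum_eq_coeff (p : NcPoly) (w₀ : FreeMonoid (Fin 2)) (f : FreeMonoid (Fin 2) → ℝ)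
    (hf : ∀ w, f w = if w.toList = w₀.toList then 1 else 0) :
    (p.coeff.sum fun w x => x * f w) = p.coeff w₀ := by
  classical
  rw [Finsupp.sum, Finset.sum_eq_single w₀]
  · simp [hf]
  · intro w _ hw
    rw [hf, if_neg, mul_zero]
    exact fun h => hw (FreeMonoid.toList.injective h)
  · intro h
    rw [Finsupp.notMem_support_iff.1 h, zero_mul]

theorem sum_eq_zero (p : NcPoly) (f : FreeMonoid (Fin 2) → ℝ) (hf : ∀ w, f w = 0) :
    (p.coeff.sum fun w x => x * f w) = 0 := by
  simp [hf]

theorem sum_filter_eq (p : NcPoly) (Q : FreeMonoid (Fin 2) → Prop) [DecidablePred Q] :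
    (∑ w ∈ p.coeff.support with Q w, p.coeff w) =
      p.coeff.sum fun w x => x * if Q w then 1 else 0 := by
  rw [Finset.sum_filter, Finsupp.sum]
  simp

theorem sum_filter_eq_coeff (p : NcPoly) (Q : FreeMonoid (Fin 2) → Prop) [DecidablePred Q]
    (l : List (Fin 2)) (h : ∀ w : FreeMonoid (Fin 2), Q w ↔ w.toList = l) :
    (∑ w ∈ p.coeff.support with Q w, p.coeff w) = p.coeff (FreeMonoid.ofList l) := by
  rw [sum_filter_eq]
  exact sum_eq_coeff p _ _ fun w => by
    by_cases hw : w.toList = l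
    · simp [(h w).2 hw, hw]
    · simp [mt (h w).1 hw, hw]

/-! ### Letter counts, and the values of `φ` that belong to a single word -/

theorem count_add_count (w : List (Fin 2)) : w.count 0 + w.count 1 = w.length := by
  induction w with
  | nil => simp
  | cons a w ih => fin_cases a <;> simp <;> omega

theorem count_zero_iff (w : List (Fin 2)) (n : ℕ) :
    (w.count 0 = n ∧ w.count 1 = 0) ↔ w = List.replicate n 0 := by
  have := count_add_count w
  constructor
  · rintro ⟨h0, h1⟩
    rw [List.eq_replicate_iff]
    refine ⟨by omega, fun b hb => ?_⟩
    rw [List.count_eq_zero] at h1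
    fin_cases b
    · rfl
    · exact absurd hb h1
  · rintro rfl
    simp [List.count_replicate]

theorem count_one_iff (w : List (Fin 2)) (n : ℕ) :
    (w.count 0 = 0 ∧ w.count 1 = n) ↔ w = List.replicate n 1 := by
  have := count_add_count w
  constructor
  · rintro ⟨h0, h1⟩
    rw [List.eq_replicate_iff]
    refine ⟨by omega, fun b hb => ?_⟩
    rw [List.count_eq_zero] at h0
    fin_cases b
    · exact absurd hb h0
    · rfl
  · rintro rfl
    simp [List.count_replicate]

theorem phi_zero_right (p : NcPoly) (n : ℕ) :
    p.phi n 0 = p.coeff (FreeMonoid.ofList (List.replicate n 0)) :=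
  sum_filter_eq_coeff _ _ _ fun _ => count_zero_iff _ _

theorem phi_zero_left (p : NcPoly) (n : ℕ) :
    p.phi 0 n = p.coeff (FreeMonoid.ofList (List.replicate n 1)) :=
  sum_filter_eq_coeff _ _ _ fun _ => count_one_iff _ _

theorem phiEnd_one (p : NcPoly) (n : ℕ) :
    p.phiEnd n 1 1 = p.coeff (FreeMonoid.ofList (List.replicate n 0 ++ [1])) := by
  refine sum_filter_eq_coeff _ _ _ fun w => ⟨?_, fun h => ?_⟩
  · rintro ⟨⟨h0, h1⟩, h⟩
    obtain ⟨l, hl⟩ := List.getLast?_eq_some_iff.1 h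
    rw [hl] at h0 h1 ⊢
    rw [← (count_zero_iff l n).1 ⟨by simpa using h0, by simpa using h1⟩]
  · rw [h]
    simp [List.count_replicate]

theorem phiStart_one (p : NcPoly) (n : ℕ) :
    p.phiStart 1 n 1 = p.coeff (FreeMonoid.ofList (1 :: List.replicate n 0)) := by
  refine sum_filter_eq_coeff _ _ _ fun w => ⟨?_, fun h => ?_⟩
  · rintro ⟨⟨h0, h1⟩, h⟩
    obtain ⟨l, hl⟩ := List.head?_eq_some_iff.1 h
    rw [hl] at h0 h1 ⊢
    rw [← (count_zero_iff l n).1 ⟨by simpa using h0, by simpa using h1⟩]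
  · rw [h]
    simp [List.count_replicate]

/-! ## Words of given lengths -/

/-- The part of `p` that consists of the words whose length is in `Q`. -/
noncomputable def select (Q : Set ℕ) (p : NcPoly) : NcPoly :=
  open scoped Classical in
  MonoidAlgebra.ofCoeff (p.coeff.filter fun w => w.toList.length ∈ Q)

open scoped Classical in
theorem select_sum {M : Type*} [AddCommMonoid M] (Q : Set ℕ) (p : NcPoly)
    (f : FreeMonoid (Fin 2) → ℝ → M) :
    (select Q p).coeff.sum f =
      p.coeff.sum fun w x => if w.toList.length ∈ Q then f w x else 0 := by
  rw [select, MonoidAlgebra.coeff_ofCoeff, Finsupp.sum, Finsupp.sum, Finsupp.support_filter,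
    Finset.sum_filter]
  refine Finset.sum_congr rfl fun w _ => ?_
  split_ifs with h
  · rw [Finsupp.filter_apply, if_pos h]
  · rfl

theorem degree_select_le (d : ℕ) (p : NcPoly) : (select (Set.Iic d) p).degree ≤ d := by
  refine Finset.sup_le fun w hw => ?_
  by_contra h
  rw [Finsupp.mem_support_iff, select, MonoidAlgebra.coeff_ofCoeff,
    Finsupp.filter_apply, if_neg (by exact h)] at hw
  exact hw rfl

theorem sum_filter_select {Q : Set ℕ} (p : NcPoly) (C : FreeMonoid (Fin 2) → Prop)
    [DecidablePred C] (h : ∀ w, C w → w.toList.length ∈ Q) :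
    (∑ w ∈ (select Q p).coeff.support with C w, (select Q p).coeff w) =
      ∑ w ∈ p.coeff.support with C w, p.coeff w := by
  classical
  rw [sum_filter_eq, sum_filter_eq, select_sum]
  refine Finset.sum_congr rfl fun w _ => ?_
  by_cases hw : C w
  · simp [h w hw]
  · simp [hw]

theorem phi_select {Q : Set ℕ} (p : NcPoly) {i j : ℕ} (h : i + j ∈ Q) :
    (select Q p).phi i j = p.phi i j :=
  sum_filter_select _ _ fun w hw => by rwa [← count_add_count, hw.1, hw.2]

theorem phiEnd_select {Q : Set ℕ} (p : NcPoly) {i j : ℕ} (l : Fin 2) (h : i + j ∈ Q) :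
    (select Q p).phiEnd i j l = p.phiEnd i j l :=
  sum_filter_select _ _ fun w hw => by rwa [← count_add_count, hw.1.1, hw.1.2]

theorem phiStart_select {Q : Set ℕ} (p : NcPoly) {i j : ℕ} (l : Fin 2) (h : i + j ∈ Q) :
    (select Q p).phiStart l i j = p.phiStart l i j :=
  sum_filter_select _ _ fun w hw => by rwa [← count_add_count, hw.1.1, hw.1.2]

theorem two_le_degree (p : NcPoly) {t : ℕ} (ht : 2 ≤ t) (h : p.phi t 0 ≠ 0) : 1 < p.degree := by
  rw [phi_zero_right] at h
  refine lt_of_lt_of_le ht ?_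
  have := Finset.le_sup (f := fun w : FreeMonoid (Fin 2) => w.toList.length)
    (Finsupp.mem_support_iff.2 h)
  simpa [degree] using this

/-! ## Interchange of the letters, and reversal of words -/

/-- The action on nc polynomials of a permutation of the words. -/
noncomputable def permute (e : Equiv.Perm (FreeMonoid (Fin 2))) (p : NcPoly) : NcPoly :=
  MonoidAlgebra.ofCoeff (p.coeff.equivMapDomain e)

theorem permute_sum {M : Type*} [AddCommMonoid M] (e : Equiv.Perm (FreeMonoid (Fin 2)))
    (p : NcPoly) (f : FreeMonoid (Fin 2) → ℝ → M) (hf : ∀ w, f w 0 = 0)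
    (hf' : ∀ w x y, f w (x + y) = f w x + f w y) :
    (permute e p).coeff.sum f = p.coeff.sum fun w x => f (e w) x := by
  rw [permute, MonoidAlgebra.coeff_ofCoeff, Finsupp.equivMapDomain_eq_mapDomain,
    Finsupp.sum_mapDomain_index hf hf']

theorem sum_filter_permute (e : Equiv.Perm (FreeMonoid (Fin 2))) (p : NcPoly)
    (C C' : FreeMonoid (Fin 2) → Prop) [DecidablePred C] [DecidablePred C']
    (h : ∀ w, C (e w) ↔ C' w) :
    (∑ w ∈ (permute e p).coeff.support with C w, (permute e p).coeff w) =
      ∑ w ∈ p.coeff.support with C' w, p.coeff w := by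
  rw [sum_filter_eq, sum_filter_eq, permute_sum]
  · refine Finset.sum_congr rfl fun w _ => ?_
    simp [h]
  · simp
  · intros; ring

/-- Interchange of the two letters in words. -/
def swapWords : Equiv.Perm (FreeMonoid (Fin 2)) where
  toFun w := FreeMonoid.ofList (w.toList.map (Equiv.swap 0 1))
  invFun w := FreeMonoid.ofList (w.toList.map (Equiv.swap 0 1))
  left_inv w := by
    apply FreeMonoid.toList.injective
    simp [Function.comp_def]
  right_inv w := by
    apply FreeMonoid.toList.injective
    simp [Function.comp_def]

/-- Reversal of words. -/
def reverseWords : Equiv.Perm (FreeMonoid (Fin 2)) where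
  toFun w := FreeMonoid.ofList w.toList.reverse
  invFun w := FreeMonoid.ofList w.toList.reverse
  left_inv w := by simp
  right_inv w := by simp

/-- Interchange of the two letters. -/
noncomputable def swapLetters (p : NcPoly) : NcPoly := permute swapWords p

/-- Reversal of all words. -/
noncomputable def reverse (p : NcPoly) : NcPoly := permute reverseWords p

theorem eval_swapLetters {R : Type*} [Semiring R] [Algebra ℝ R] (a b : R) (p : NcPoly) :
    p.swapLetters.eval a b = p.eval b a := by
  rw [eval_eq_sum, eval_eq_sum, swapLetters, permute_sum]
  · refine Finset.sum_congr rfl fun w _ => ?_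
    have : ![a, b] ∘ (Equiv.swap 0 1) = ![b, a] := by
      funext l; fin_cases l <;> simp
    simp [swapWords, this]
  · simp
  · intros; rw [add_smul]

/-- Transposition reverses products of matrices because the entries commute. -/
theorem eval_reverse {ι R : Type*} [Fintype ι] [DecidableEq ι] [CommSemiring R] [Algebra ℝ R]
    (A B : Matrix ι ι R) (p : NcPoly) :
    p.reverse.eval A.transpose B.transpose = (p.eval A B).transpose := by
  rw [eval_eq_sum, eval_eq_sum, reverse, permute_sum, Finsupp.sum, Finsupp.sum,
    Matrix.transpose_sum]
  · refine Finset.sum_congr rfl fun w _ => ?_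
    rw [Matrix.transpose_smul, Matrix.transpose_list_prod, List.map_map]
    have : Matrix.transpose ∘ ![A, B] = ![A.transpose, B.transpose] := by
      funext l; fin_cases l <;> simp
    simp [reverseWords, this]
  · simp
  · intros; rw [add_smul]

theorem count_swap (w : List (Fin 2)) :
    (w.map (Equiv.swap 0 1)).count 0 = w.count 1 ∧ (w.map (Equiv.swap 0 1)).count 1 = w.count 0 := by
  induction w with
  | nil => simp
  | cons a w ih => fin_cases a <;> simp [ih.1, ih.2]

theorem phi_swapLetters (p : NcPoly) (i j : ℕ) : p.swapLetters.phi i j = p.phi j i :=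
  sum_filter_permute _ _ _ _ fun w => by simp [swapWords, count_swap, and_comm]

theorem phiEnd_swapLetters (p : NcPoly) (i j : ℕ) (l : Fin 2) :
    p.swapLetters.phiEnd i j l = p.phiEnd j i (Equiv.swap 0 1 l) :=
  sum_filter_permute _ _ _ _ fun w => by
    simp only [swapWords, Equiv.coe_fn_mk, FreeMonoid.toList_ofList, count_swap, List.getLast?_map,
      Option.map_eq_some_iff]
    rw [and_comm (a := w.toList.count 1 = i)]
    refine and_congr_right fun _ => ⟨?_, fun h => ⟨_, h, by simp⟩⟩
    rintro ⟨x, h, rfl⟩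
    simpa using h

theorem phiStart_swapLetters (p : NcPoly) (i j : ℕ) (l : Fin 2) :
    p.swapLetters.phiStart l i j = p.phiStart (Equiv.swap 0 1 l) j i :=
  sum_filter_permute _ _ _ _ fun w => by
    simp only [swapWords, Equiv.coe_fn_mk, FreeMonoid.toList_ofList, count_swap, List.head?_map,
      Option.map_eq_some_iff]
    rw [and_comm (a := w.toList.count 1 = i)]
    refine and_congr_right fun _ => ⟨?_, fun h => ⟨_, h, by simp⟩⟩
    rintro ⟨x, h, rfl⟩
    simpa using h

theorem phi_reverse (p : NcPoly) (i j : ℕ) : p.reverse.phi i j = p.phi i j :=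
  sum_filter_permute _ _ _ _ fun w => by simp [reverseWords]

theorem phiEnd_reverse (p : NcPoly) (i j : ℕ) (l : Fin 2) :
    p.reverse.phiEnd i j l = p.phiStart l i j :=
  sum_filter_permute _ _ _ _ fun w => by simp [reverseWords]

theorem phiStart_reverse (p : NcPoly) (i j : ℕ) (l : Fin 2) :
    p.reverse.phiStart l i j = p.phiEnd i j l :=
  sum_filter_permute _ _ _ _ fun w => by simp [reverseWords]

end NcPoly

/-- The condition on `t` in the definition of the class `𝒲`. -/
def Separated (p : NcPoly) (t : ℕ) : Prop :=
  p.phi t 0 ≠ 0 ∧ p.phi 0 t ≠ 0 ∧ p.phi t 0 ≠ p.phi 0 t ∧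
    ( (t : ℝ) * p.phi t 0 ≠ p.phi (t - 1) 1 ∨
      (t : ℝ) * p.phi 0 t ≠ p.phi 1 (t - 1) ∨
      (p.phiEnd (t - 1) 1 1 ≠ 0 ∧ p.phi t 0 ≠ p.phiEnd (t - 1) 1 1) ∨
      (p.phiStart 1 (t - 1) 1 ≠ 0 ∧ p.phi t 0 ≠ p.phiStart 1 (t - 1) 1) ∨
      (p.phiEnd 1 (t - 1) 0 ≠ 0 ∧ p.phi 0 t ≠ p.phiEnd 1 (t - 1) 0) ∨
      (p.phiStart 0 1 (t - 1) ≠ 0 ∧ p.phi 0 t ≠ p.phiStart 0 1 (t - 1)) )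

/-- The degree clause of `𝒲` is implied: `φ(t,0) ≠ 0` exhibits a word of length `t ≥ 2`. -/
theorem mem_classW_iff (p : NcPoly) : p ∈ classW ↔ ∃ t : ℕ, 2 ≤ t ∧ Separated p t :=
  ⟨fun h => h.2, fun h => ⟨by obtain ⟨t, ht, h⟩ := h; exact p.two_le_degree ht h.1, h⟩⟩

/-- The interchange permutes the six alternatives: 1 with 2, 3 with 5, 4 with 6. Reversal, below,
exchanges 3 with 4 and 5 with 6. -/
theorem Separated.swapLetters {p : NcPoly} {t : ℕ} (h : Separated p t) :
    Separated p.swapLetters t := by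
  simp only [Separated, NcPoly.phi_swapLetters, NcPoly.phiEnd_swapLetters,
    NcPoly.phiStart_swapLetters, Equiv.swap_apply_left, Equiv.swap_apply_right] at h ⊢
  exact ⟨h.2.1, h.1, h.2.2.1.symm, by tauto⟩

theorem Separated.reverse {p : NcPoly} {t : ℕ} (h : Separated p t) : Separated p.reverse t := by
  simp only [Separated, NcPoly.phi_reverse, NcPoly.phiEnd_reverse, NcPoly.phiStart_reverse] at h ⊢
  exact ⟨h.1, h.2.1, h.2.2.1, by tauto⟩

/-- Every word that enters the condition for `t` has length exactly `t`. -/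
theorem Separated.select {p : NcPoly} {t d : ℕ} (ht : 2 ≤ t) (htd : t ≤ d) (h : Separated p t) :
    Separated (NcPoly.select (Set.Iic d) p) t := by
  have h1 : t + 0 ∈ Set.Iic d := by simpa
  have h2 : 0 + t ∈ Set.Iic d := by simpa
  have h3 : t - 1 + 1 ∈ Set.Iic d := by simp; omega
  have h4 : 1 + (t - 1) ∈ Set.Iic d := by simp; omega
  simpa only [Separated, NcPoly.phi_select p h1, NcPoly.phi_select p h2, NcPoly.phi_select p h3,
    NcPoly.phi_select p h4, NcPoly.phiEnd_select p _ h3, NcPoly.phiEnd_select p _ h4,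
    NcPoly.phiStart_select p _ h3, NcPoly.phiStart_select p _ h4] using h

/-! ## Coefficients of nc polynomials in two generic matrices -/

section GenericEval

variable {ι V : Type*} [Fintype ι] [DecidableEq ι]
  {z : Fin 2 → ι → ι → V}

/-- The value of an nc polynomial at two generic matrices. -/
noncomputable def genericEval (z : Fin 2 → ι → ι → V) (p : NcPoly) :
    Matrix ι ι (MvPolynomial V ℝ) :=
  p.eval (letterMat z 0) (letterMat z 1)

/-- The coefficient of a word given as a list. -/
noncomputable def NcPoly.wcoeff (p : NcPoly) (w : List (Fin 2)) : ℝ := p.coeff (FreeMonoid.ofList w)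

theorem coeff_genericEval (p : NcPoly) (r s : ι) (m : V →₀ ℕ) :
    MvPolynomial.coeff m (genericEval z p r s) =
      p.coeff.sum fun w x => x * wordCoeff z w.toList r s m := by
  have h : ![letterMat z 0, letterMat z 1] = letterMat z := by
    funext l; fin_cases l <;> rfl
  rw [genericEval, NcPoly.eval_apply, Finsupp.sum, MvPolynomial.coeff_sum, h]
  simp only [MvPolynomial.coeff_smul, smul_eq_mul]
  rfl

/-- Transfer from words to `p`: a monomial that comes from one word only, with multiplicity one,
displays the coefficient of that word. -/
theorem coeff_genericEval_of_word (p : NcPoly) (r s : ι) (m : V →₀ ℕ) (C : Prop) [Decidable C]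
    (w₀ : List (Fin 2))
    (h : ∀ w, wordCoeff z w r s m = if C ∧ w = w₀ then 1 else 0) :
    MvPolynomial.coeff m (genericEval z p r s) = if C then p.wcoeff w₀ else 0 := by
  rw [coeff_genericEval]
  split_ifs with hC
  · exact p.sum_eq_coeff _ _ fun w => by
      rw [h]
      by_cases hw : w.toList = w₀ <;> simp [hC, hw]
  · exact p.sum_eq_zero _ fun w => by rw [h]; simp [hC]

theorem coeff_genericEval_zero (p : NcPoly) (r s : ι) (m : V →₀ ℕ)
    (h : ∀ w, wordCoeff z w r s m = 0) :
    MvPolynomial.coeff m (genericEval z p r s) = 0 := by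
  rw [coeff_genericEval]
  exact p.sum_eq_zero _ fun w => h _

variable [DecidableEq V]

theorem wordCoeff_eq_zero_of_degree (w : List (Fin 2)) (r s : ι) (m : V →₀ ℕ)
    (h : m.degree ≠ w.length) : wordCoeff z w r s m = 0 := by
  induction w generalizing r m with
  | nil =>
    rw [wordCoeff_nil, if_neg]
    rintro ⟨_, rfl⟩
    simp at h
  | cons l w ih =>
    rw [wordCoeff_cons]
    refine Finset.sum_eq_zero fun j _ => ?_
    split_ifs with hj
    · apply ih
      have h1 : Finsupp.single (z l r j) 1 ≤ m := by
        rw [Finsupp.single_le_iff]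
        exact Nat.one_le_iff_ne_zero.2 (Finsupp.mem_support_iff.1 hj)
      have h2 := congrArg Finsupp.degree (tsub_add_cancel_of_le h1)
      rw [map_add, Finsupp.degree_single] at h2
      simp only [List.length_cons] at h
      omega
    · rfl

open scoped Classical in
theorem coeff_genericEval_select (Q : Set ℕ) (p : NcPoly) (r s : ι) (m : V →₀ ℕ) :
    MvPolynomial.coeff m (genericEval z (p.select Q) r s) =
      if m.degree ∈ Q then MvPolynomial.coeff m (genericEval z p r s) else 0 := by
  rw [coeff_genericEval, coeff_genericEval, NcPoly.select_sum, Finsupp.sum, Finsupp.sum]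
  split_ifs with h
  · refine Finset.sum_congr rfl fun w _ => ?_
    split_ifs with hw
    · rfl
    · rw [wordCoeff_eq_zero_of_degree, mul_zero]
      exact fun h' => hw (by rwa [← h'])
  · refine Finset.sum_eq_zero fun w _ => ?_
    split_ifs with hw
    · rw [wordCoeff_eq_zero_of_degree, mul_zero]
      exact fun h' => h (by rwa [h'])
    · rfl

theorem homogeneousComponent_genericEval (n : ℕ) (p : NcPoly) (r s : ι) :
    MvPolynomial.homogeneousComponent n (genericEval z p r s) = genericEval z (p.select {n}) r s := by
  classical
  ext m
  rw [MvPolynomial.coeff_homogeneousComponent, coeff_genericEval_select]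
  simp

/-- A representation may contain longer words whose contributions cancel, for instance a polynomial
identity of `k × k` matrices. Evaluation respects degrees, so these words can be dropped. -/
theorem genericEval_select_of_totalDegree_le {d : ℕ} (p : NcPoly) (r s : ι)
    (h : (genericEval z p r s).totalDegree ≤ d) :
    genericEval z (p.select (Set.Iic d)) r s = genericEval z p r s := by
  classical
  ext m
  rw [coeff_genericEval_select]
  split_ifs with hm
  · rfl
  · rw [MvPolynomial.coeff_eq_zero_of_totalDegree_lt]
    rw [Set.mem_Iic, not_le] at hm
    exact lt_of_le_of_lt h hm

theorem coeff_genericEval_pow (hz : Generic z) (p : NcPoly) (l : Fin 2) (i r s : ι) {n : ℕ}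
    (hn : n ≠ 0) :
    MvPolynomial.coeff (Finsupp.single (z l i i) n) (genericEval z p r s) =
      if r = i ∧ s = i then p.wcoeff (List.replicate n l) else 0 := by
  refine coeff_genericEval_of_word _ _ _ _ _ _ fun w => ?_
  rw [wordCoeff_pow hz]
  congr 1
  simp only [hn, false_or, eq_iff_iff]
  constructor
  · rintro ⟨rfl, h1, rfl⟩
    exact ⟨⟨rfl, rfl⟩, h1⟩
  · rintro ⟨⟨rfl, rfl⟩, h1⟩
    exact ⟨rfl, h1, rfl⟩

theorem coeff_genericEval_pow_offdiag (hz : Generic z) (p : NcPoly) (l : Fin 2) {a b : ι}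
    (hab : a ≠ b) (r s : ι) {n : ℕ} (hn : 2 ≤ n) :
    MvPolynomial.coeff (Finsupp.single (z l a b) n) (genericEval z p r s) = 0 :=
  coeff_genericEval_zero _ _ _ _ fun w => wordCoeff_pow_offdiag hz l hab w hn r s

theorem coeff_genericEval_two (hz : Generic z) (p : NcPoly) (l l' : Fin 2) (i : ι) {a b : ι}
    (hab : a ≠ b) (r s : ι) {N : ℕ} (hN : N ≠ 0) :
    MvPolynomial.coeff (Finsupp.single (z l i i) N + Finsupp.single (z l' a b) 1)
      (genericEval z p r s) =
      if r = a ∧ s = b then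
        if i = a then p.wcoeff (List.replicate N l ++ [l'])
        else if i = b then p.wcoeff (l' :: List.replicate N l) else 0
      else 0 := by
  by_cases hia : i = a
  · rw [if_pos hia]
    refine coeff_genericEval_of_word _ _ _ _ _ _ fun w => ?_
    have hib : i ≠ b := fun h => hab (hia.symm.trans h)
    rw [wordCoeff_two_offdiag hz _ _ _ hab]
    simp [hN, hia, hab, and_assoc]
  · rw [if_neg hia]
    by_cases hib : i = b
    · rw [if_pos hib]
      refine coeff_genericEval_of_word _ _ _ _ _ _ fun w => ?_
      rw [wordCoeff_two_offdiag hz _ _ _ hab]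
      simp [hN, hib, hab.symm, and_assoc]
    · rw [if_neg hib, ite_self]
      refine coeff_genericEval_zero _ _ _ _ fun w => ?_
      rw [wordCoeff_two_offdiag hz _ _ _ hab]
      simp [hN, hib, hia]

theorem coeff_genericEval_two_diag (hz : Generic z) (p : NcPoly) (l l' : Fin 2) (i a : ι)
    (huv : ¬ (l = l' ∧ i = a)) (r s : ι) (N : ℕ) (h : r ≠ s ∨ i ≠ a ∧ N ≠ 0) :
    MvPolynomial.coeff (Finsupp.single (z l i i) N + Finsupp.single (z l' a a) 1)
      (genericEval z p r s) = 0 :=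
  coeff_genericEval_zero _ _ _ _ fun w => wordCoeff_two_diag hz l l' i a huv w N r s h

theorem coeff_genericEval_three (hz : Generic z) (p : NcPoly) (l : Fin 2) {i h r : ι} (hir : i ≠ r)
    (hhi : h ≠ i) (hhr : h ≠ r) (N : ℕ) (f g : Bool) :
    MvPolynomial.coeff (Finsupp.single (z l i i) N +
      Finsupp.single (if f then z l i h else z l h i) 1 +
      Finsupp.single (if g then z l h r else z l r h) 1) (genericEval z p i r) =
      if f ∧ g then p.wcoeff (List.replicate (N + 2) l) else 0 := by
  refine coeff_genericEval_of_word _ _ _ _ _ _ fun w => ?_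
  rw [wordCoeff_three hz l hir hhi hhr]
  simp only [and_assoc]

end GenericEval

namespace NcPoly

/-! ## Evaluations at special matrices -/

/-- If the value of a word depends only on its letter counts, then only the sums `φ` matter. This
applies to commuting arguments, as in the substitution `X = I` and in the probes of DiagPar1. -/
theorem sum_pow_mul_pow (p : NcPoly) (n : ℕ) {M : Type*} [AddCommMonoid M] [Module ℝ M]
    (f : ℕ → ℕ → M) :
    ((p.select {n}).coeff.sum fun w x => x • f (w.toList.count 0) (w.toList.count 1)) =
      ∑ j ∈ Finset.range (n + 1), p.phi (n - j) j • f (n - j) j := by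
  classical
  rw [select_sum]
  simp only [phi, sum_filter_eq, Finsupp.sum, Finset.sum_smul]
  rw [Finset.sum_comm]
  refine Finset.sum_congr rfl fun w _ => ?_
  have h := count_add_count w.toList
  split_ifs with hw
  · rw [Set.mem_singleton_iff] at hw
    rw [Finset.sum_eq_single (w.toList.count 1)]
    · have h0 : w.toList.count 0 = n - w.toList.count 1 := by omega
      rw [h0, if_pos ⟨rfl, rfl⟩, mul_one]
    · intro j _ hj
      rw [if_neg (fun h => hj h.2.symm), mul_zero, zero_smul]
    · intro h'
      exact absurd (Finset.mem_range.2 (by omega)) h'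
  · refine (Finset.sum_eq_zero fun j hj => ?_).symm
    rw [Finset.mem_range] at hj
    rw [if_neg, mul_zero, zero_smul]
    rintro ⟨h1, h2⟩
    rw [Set.mem_singleton_iff] at hw
    omega

theorem word_prod_of_commute {R : Type*} [Monoid R] {a b : R} (h : Commute a b)
    (w : List (Fin 2)) : (w.map ![a, b]).prod = a ^ w.count 0 * b ^ w.count 1 := by
  induction w with
  | nil => simp
  | cons l w ih =>
    fin_cases l
    · simp [ih, pow_succ', mul_assoc]
    · simp only [Fin.mk_one, List.map_cons, List.prod_cons, ih]
      simp [pow_succ', ← mul_assoc, (h.pow_left (w.count 0)).eq]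

theorem eval_select_of_commute {R : Type*} [Semiring R] [Algebra ℝ R] {a b : R}
    (h : Commute a b) (p : NcPoly) (n : ℕ) :
    (p.select {n}).eval a b =
      ∑ j ∈ Finset.range (n + 1), p.phi (n - j) j • (a ^ (n - j) * b ^ j) := by
  rw [eval_eq_sum, ← sum_pow_mul_pow p n fun i j => a ^ i * b ^ j]
  simp only [word_prod_of_commute h]

end NcPoly

/-! ## Arrangements -/

theorem aeval_genericEval {ι V R : Type*} [Fintype ι] [DecidableEq ι] [CommSemiring R] [Algebra ℝ R]
    (z : Fin 2 → ι → ι → V) (g : V → R) (p : NcPoly) (r s : ι) :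
    MvPolynomial.aeval g (genericEval z p r s) =
      p.eval (Matrix.of fun i j => g (z 0 i j)) (Matrix.of fun i j => g (z 1 i j)) r s := by
  have h := NcPoly.map_eval (MvPolynomial.aeval (R := ℝ) g).mapMatrix (letterMat z 0) (letterMat z 1) p
  have hl : ∀ l, (MvPolynomial.aeval (R := ℝ) g).mapMatrix (letterMat z l) =
      Matrix.of fun i j => g (z l i j) := by
    intro l
    ext i j
    simp [letterMat]
  rw [hl, hl] at h
  rw [← h, genericEval]
  rfl

namespace Arrangement

variable {k : ℕ}

/-- The variables of the arrangement: those of `X` for the letter `0`, those of `Y` for `1`. -/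
def var (A : Arrangement k) : Fin 2 → Fin k → Fin k → Var k :=
  fun l => ![A.X, A.Y] l

theorem var_zero (A : Arrangement k) (i j : Fin k) : A.var 0 i j = A.X i j := rfl

theorem var_one (A : Arrangement k) (i j : Fin k) : A.var 1 i j = A.Y i j := rfl

theorem generic (A : Arrangement k) : Generic A.var := by
  intro l i j l' i' j' h
  have hi := A.var_bij.injective
  fin_cases l <;> fin_cases l'
  · have := @hi (Sum.inl (i, j)) (Sum.inl (i', j')) h
    simpa using this
  · have := @hi (Sum.inl (i, j)) (Sum.inr (i', j')) h
    simp at this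
  · have := @hi (Sum.inr (i, j)) (Sum.inl (i', j')) h
    simp at this
  · have := @hi (Sum.inr (i, j)) (Sum.inr (i', j')) h
    simpa using this

theorem exists_var (A : Arrangement k) (v : Var k) : ∃ l i j, A.var l i j = v := by
  obtain ⟨e | e, h⟩ := A.var_bij.surjective v
  · exact ⟨0, e.1, e.2, h⟩
  · exact ⟨1, e.1, e.2, h⟩

theorem exists_L (A : Arrangement k) (q : Fin (k ^ 2)) : ∃ i j, A.L i j = q := by
  obtain ⟨e, h⟩ := A.pol_bij.surjective q
  exact ⟨e.1, e.2, h⟩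

theorem L_eq_iff (A : Arrangement k) {i j i' j' : Fin k} :
    A.L i j = A.L i' j' ↔ i = i' ∧ j = j' := by
  rw [← Prod.mk.injEq]
  exact A.pol_bij.injective.eq_iff (a := (i, j)) (b := (i', j'))

/-- The variables on the diagonal of `X`. -/
def xDiag (A : Arrangement k) : Finset (Var k) := Finset.univ.image fun i => A.X i i

/-- The variables of `X`. -/
def xSet (A : Arrangement k) : Finset (Var k) :=
  Finset.univ.image fun e : Fin k × Fin k => A.X e.1 e.2

theorem var_mem_xDiag (A : Arrangement k) {l : Fin 2} {i j : Fin k} :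
    A.var l i j ∈ A.xDiag ↔ l = 0 ∧ i = j := by
  simp only [xDiag, Finset.mem_image, Finset.mem_univ, true_and, ← var_zero, A.generic.eq_iff]
  constructor
  · rintro ⟨a, rfl, rfl, rfl⟩; simp
  · rintro ⟨rfl, rfl⟩; exact ⟨i, rfl, rfl, rfl⟩

theorem var_mem_xSet (A : Arrangement k) {l : Fin 2} {i j : Fin k} :
    A.var l i j ∈ A.xSet ↔ l = 0 := by
  simp only [xSet, Finset.mem_image, Finset.mem_univ, true_and, ← var_zero, A.generic.eq_iff]
  constructor
  · rintro ⟨a, rfl, _⟩; rfl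
  · rintro rfl; exact ⟨(i, j), rfl, rfl, rfl⟩

theorem card_xDiag (A : Arrangement k) : A.xDiag.card = k := by
  rw [xDiag, Finset.card_image_of_injective, Finset.card_univ, Fintype.card_fin]
  intro i j h
  exact (A.generic 0 _ _ 0 _ _ h).2.1

theorem card_xSet (A : Arrangement k) : A.xSet.card = k ^ 2 := by
  rw [xSet, Finset.card_image_of_injective, Finset.card_univ, Fintype.card_prod, Fintype.card_fin,
    sq]
  intro e e' h
  have := A.generic 0 _ _ 0 _ _ h
  exact Prod.ext this.2.1 this.2.2

theorem xDiag_subset_xSet (A : Arrangement k) : A.xDiag ⊆ A.xSet := by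
  intro v hv
  obtain ⟨l, i, j, rfl⟩ := A.exists_var v
  exact A.var_mem_xSet.2 (A.var_mem_xDiag.1 hv).1

/-- Simultaneous permutation of the rows and columns. -/
def conj (A : Arrangement k) (σ : Equiv.Perm (Fin k)) : Arrangement k where
  X := A.X.submatrix σ σ
  Y := A.Y.submatrix σ σ
  L := A.L.submatrix σ σ
  var_bij := by
    have := A.var_bij.comp (Equiv.sumCongr (Equiv.prodCongr σ σ) (Equiv.prodCongr σ σ)).bijective
    convert this using 1
    ext (e | e) <;> rfl
  pol_bij := A.pol_bij.comp (Equiv.prodCongr σ σ).bijective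

/-- Transposition. -/
def transpose (A : Arrangement k) : Arrangement k where
  X := A.X.transpose
  Y := A.Y.transpose
  L := A.L.transpose
  var_bij := by
    have := A.var_bij.comp (Equiv.sumCongr (Equiv.prodComm (Fin k) (Fin k))
      (Equiv.prodComm (Fin k) (Fin k))).bijective
    convert this using 1
    ext (e | e) <;> rfl
  pol_bij := A.pol_bij.comp (Equiv.prodComm (Fin k) (Fin k)).bijective

/-- Interchange of `X` and `Y`. -/
def swap (A : Arrangement k) : Arrangement k where
  X := A.Y
  Y := A.X
  L := A.L
  var_bij := by
    have := A.var_bij.comp (Equiv.sumComm (Fin k × Fin k) (Fin k × Fin k)).bijective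
    convert this using 1
    ext (e | e) <;> rfl
  pol_bij := A.pol_bij

theorem xSet_conj (A : Arrangement k) (σ : Equiv.Perm (Fin k)) : (A.conj σ).xSet = A.xSet := by
  ext v
  simp only [xSet, Finset.mem_image, Finset.mem_univ, true_and, Prod.exists]
  exact ⟨fun ⟨i, j, h⟩ => ⟨σ i, σ j, h⟩, fun ⟨i, j, h⟩ => ⟨σ.symm i, σ.symm j, by simpa [conj]⟩⟩

theorem xDiag_conj (A : Arrangement k) (σ : Equiv.Perm (Fin k)) : (A.conj σ).xDiag = A.xDiag := by
  ext v
  simp only [xDiag, Finset.mem_image, Finset.mem_univ, true_and]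
  exact ⟨fun ⟨i, h⟩ => ⟨σ i, h⟩, fun ⟨i, h⟩ => ⟨σ.symm i, by simpa [conj]⟩⟩

theorem xSet_transpose (A : Arrangement k) : A.transpose.xSet = A.xSet := by
  ext v
  simp only [xSet, Finset.mem_image, Finset.mem_univ, true_and, Prod.exists]
  exact ⟨fun ⟨i, j, h⟩ => ⟨j, i, h⟩, fun ⟨i, j, h⟩ => ⟨j, i, h⟩⟩

theorem xDiag_transpose (A : Arrangement k) : A.transpose.xDiag = A.xDiag := rfl

end Arrangement

/-! ## Nc representations -/

section Representations

open OneLetter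

variable {k : ℕ} {P : Family k} {A : Arrangement k} {p p' : NcPoly}

theorem isNcRep_iff : IsNcRep P A p ↔ ∀ r s, P (A.L r s) = genericEval A.var p r s := by
  rw [IsNcRep, ← Matrix.ext_iff]
  exact forall₂_congr fun r s => eq_comm

namespace IsNcRep

theorem apply (h : IsNcRep P A p) (r s : Fin k) : P (A.L r s) = genericEval A.var p r s :=
  isNcRep_iff.1 h r s

/-- Simultaneous permutation of rows and columns is an algebra automorphism, so `p` is unchanged.
This symmetry, transposition and the interchange of letters absorb every ambiguity in what the
algorithms can reconstruct. -/
theorem conj (h : IsNcRep P A p) (σ : Equiv.Perm (Fin k)) : IsNcRep P (A.conj σ) p := by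
  have h1 := NcPoly.map_eval (Matrix.reindexAlgEquiv ℝ (MvPolynomial (Var k) ℝ) σ.symm).toAlgHom
    (A.X.map (MvPolynomial.X (R := ℝ))) (A.Y.map (MvPolynomial.X (R := ℝ))) p
  rw [show p.eval _ _ = _ from h] at h1
  exact h1.symm

theorem transpose (h : IsNcRep P A p) : IsNcRep P A.transpose p.reverse := by
  have h1 := NcPoly.eval_reverse (A.X.map (MvPolynomial.X (R := ℝ)))
    (A.Y.map (MvPolynomial.X (R := ℝ))) p
  rw [show p.eval _ _ = _ from h] at h1
  exact h1

theorem swap (h : IsNcRep P A p) : IsNcRep P A.swap p.swapLetters :=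
  (NcPoly.eval_swapLetters _ _ p).trans h

theorem select (h : IsNcRep P A p) :
    IsNcRep P A (p.select (Set.Iic (OneLetter.famDegree P))) := by
  rw [isNcRep_iff]
  intro r s
  rw [h.apply, genericEval_select_of_totalDegree_le]
  rw [← h.apply]
  exact Finset.le_sup (f := fun q => (P q).totalDegree) (Finset.mem_univ _)

theorem one_eq (h : IsNcRep P A p) {n : ℕ} (hn : 2 ≤ n) (r s : Fin k) (l : Fin 2) (a b : Fin k) :
    one P n (A.L r s) (A.var l a b) =
      if a = b ∧ r = a ∧ s = a then p.wcoeff (List.replicate n l) else 0 := by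
  rw [one, h.apply]
  by_cases hab : a = b
  · subst hab
    rw [coeff_genericEval_pow A.generic _ _ _ _ _ (by omega)]
    simp
  · rw [coeff_genericEval_pow_offdiag A.generic _ _ hab _ _ hn]
    simp [hab]

theorem one_diag (h : IsNcRep P A p) {n : ℕ} (hn : 2 ≤ n) (l : Fin 2) (a : Fin k) :
    one P n (A.L a a) (A.var l a a) = p.wcoeff (List.replicate n l) := by
  rw [h.one_eq hn]; simp

theorem diag_of_one_ne_zero (h : IsNcRep P A p) {n : ℕ} (hn : 2 ≤ n) {r s : Fin k} {l : Fin 2}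
    {a b : Fin k} (h0 : one P n (A.L r s) (A.var l a b) ≠ 0) : a = b ∧ r = a ∧ s = a := by
  by_contra hc
  rw [h.one_eq hn, if_neg hc] at h0
  exact h0 rfl

/-- For `l = 1` the two coefficients are `φ(n-1,1;Y)` and `φ(Y;n-1,1)`, which is how conditions 3
and 4 become visible in the family. -/
theorem two_offdiag (h : IsNcRep P A p) {n : ℕ} (hn : 2 ≤ n) (r s i : Fin k) (l : Fin 2)
    {a b : Fin k} (hab : a ≠ b) :
    two P n (A.L r s) (A.X i i) (A.var l a b) =
      if r = a ∧ s = b then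
        if i = a then p.wcoeff (List.replicate (n - 1) 0 ++ [l])
        else if i = b then p.wcoeff (l :: List.replicate (n - 1) 0) else 0
      else 0 := by
  rw [two, h.apply]
  exact coeff_genericEval_two A.generic p 0 l i hab r s (by omega)

theorem two_diag (h : IsNcRep P A p) {n : ℕ} {r s i a : Fin k} (hrs : r ≠ s) {l : Fin 2}
    (huv : A.var l a a ≠ A.X i i) : two P n (A.L r s) (A.X i i) (A.var l a a) = 0 := by
  rw [two, h.apply]
  refine coeff_genericEval_two_diag A.generic p 0 l i a ?_ r s _ (Or.inl hrs)
  rintro ⟨rfl, rfl⟩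
  exact huv rfl

theorem replicate_concat {n : ℕ} (hn : 2 ≤ n) (l : Fin 2) :
    List.replicate (n - 1) l ++ [l] = List.replicate n l := by
  rw [← List.replicate_succ', Nat.sub_add_cancel (by omega)]

theorem replicate_cons {n : ℕ} (hn : 2 ≤ n) (l : Fin 2) :
    l :: List.replicate (n - 1) l = List.replicate n l := by
  rw [← List.replicate_succ, Nat.sub_add_cancel (by omega)]

/-- Words in the off-diagonal entries of `X`. -/
theorem two_X (h : IsNcRep P A p) {n : ℕ} (hn : 2 ≤ n) (r s i : Fin k) {a b : Fin k}
    (hab : a ≠ b) :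
    two P n (A.L r s) (A.X i i) (A.X a b) =
      if (r = a ∧ s = b) ∧ (i = a ∨ i = b) then p.phi n 0 else 0 := by
  have h1 := h.two_offdiag hn r s i 0 hab
  rw [replicate_concat hn, replicate_cons hn, ← ite_or] at h1
  rw [← A.var_zero a b, h1, ite_and (_ ∧ _), NcPoly.phi_zero_right]
  rfl

theorem two_X_diag (h : IsNcRep P A p) {n : ℕ} (hn : 2 ≤ n) (r s i : Fin k) :
    two P n (A.L r s) (A.X i i) (A.X i i) = if r = i ∧ s = i then p.phi n 0 else 0 := by
  have h1 := h.one_eq hn r s 0 i i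
  rw [two, ← Finsupp.single_add, Nat.sub_add_cancel (by omega)]
  simp only [true_and] at h1
  rw [NcPoly.phi_zero_right]
  exact h1

/-- The flags run through the four candidate pairs in the row and column rules of ParPosX; only the
correctly oriented pair occurs. -/
theorem three_X (h : IsNcRep P A p) {n : ℕ} (hn : 2 ≤ n) {i j r : Fin k} (hir : i ≠ r)
    (hji : j ≠ i) (hjr : j ≠ r) (f g : Bool) :
    three P n (A.L i r) (A.X i i) (if f then A.X i j else A.X j i)
      (if g then A.X j r else A.X r j) = if f ∧ g then p.phi n 0 else 0 := by
  rw [three, h.apply, NcPoly.phi_zero_right]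
  have h1 := coeff_genericEval_three A.generic p 0 hir hji hjr (n - 2) f g
  rw [Nat.sub_add_cancel hn] at h1
  exact h1

/-- The value of the family after the substitution `X = I`. -/
theorem coeff_specialize (h : IsNcRep P A p) {m t : ℕ} (htm : t ≤ m) (r s : Fin k)
    (M : Var k →₀ ℕ) (hM : M.degree = t) :
    MvPolynomial.coeff M (specialize P A.xDiag A.xSet m (A.L r s)) =
      p.phi (m - t) t * wordCoeff A.var (List.replicate t 1) r s M := by
  rw [specialize, h.apply, homogeneousComponent_genericEval, aeval_genericEval]
  have h0 : (Matrix.of fun i j => (fun v => if v ∈ A.xSet then (if v ∈ A.xDiag then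
      (1 : MvPolynomial (Var k) ℝ) else 0) else MvPolynomial.X v) (A.var 0 i j)) = 1 := by
    ext1 i j
    simp [A.var_mem_xSet, A.var_mem_xDiag, Matrix.one_apply]
  have h1 : (Matrix.of fun i j => (fun v => if v ∈ A.xSet then (if v ∈ A.xDiag then
      (1 : MvPolynomial (Var k) ℝ) else 0) else MvPolynomial.X v) (A.var 1 i j)) =
        letterMat A.var 1 := by
    ext1 i j
    simp [A.var_mem_xSet, letterMat]
  have hw : ∀ j, letterMat A.var 1 ^ j = wordMat A.var (List.replicate j 1) := by
    intro j
    simp [wordMat]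
  -- With `X = I` the degree `m` part becomes `∑ φ(m-j,j) Y^j`, and monomials of degree `t` come
  -- from `j = t` alone.
  rw [h0, h1, NcPoly.eval_select_of_commute (Commute.one_left _), Matrix.sum_apply,
    MvPolynomial.coeff_sum, Finset.sum_eq_single t]
  · simp [hw, wordCoeff]
  · intro j _ hj
    have : wordCoeff A.var (List.replicate j 1) r s M = 0 := by
      apply wordCoeff_eq_zero_of_degree
      simpa [hM] using hj.symm
    rw [wordCoeff] at this
    simp [hw, this]
  · intro ht
    exact absurd (Finset.mem_range.2 (by omega)) ht

end IsNcRep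

namespace IsNcRep

/-! ## The diagonal of `X` -/

/-- In degree `n ≥ 2` the only one letter words are powers of diagonal entries, with coefficient
`φ(n,0)` for `X` and `φ(0,n)` for `Y`. -/
theorem diagVars_eq (h : IsNcRep P A p) {n : ℕ} (hn : 2 ≤ n) (h0 : p.phi n 0 ≠ 0)
    (h1 : p.phi 0 n ≠ p.phi n 0) : diagVars P n (p.phi n 0) = A.xDiag := by
  ext v
  obtain ⟨l, a, b, rfl⟩ := A.exists_var v
  rw [A.var_mem_xDiag]
  simp only [diagVars, Finset.mem_filter, Finset.mem_univ, true_and]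
  constructor
  · rintro ⟨q, hq⟩
    obtain ⟨r, s, rfl⟩ := A.exists_L q
    obtain ⟨rfl, rfl, rfl⟩ := h.diag_of_one_ne_zero hn (by rwa [hq])
    rw [h.one_diag hn] at hq
    refine ⟨?_, rfl⟩
    fin_cases l
    · rfl
    · rw [p.phi_zero_left] at h1
      exact absurd hq h1
  · rintro ⟨rfl, rfl⟩
    exact ⟨A.L a a, by rw [h.one_diag hn, p.phi_zero_right]; rfl⟩

/-- If both `φ(n,0)` and `φ(0,n)` were `a`, there would be `2k` diagonal variables with this
coefficient; if neither were, there would be none. So an accepted pair isolates the diagonal of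
exactly one matrix. -/
theorem diagOK_cases (hk : 0 < k) (h : IsNcRep P A p) {n : ℕ} (hn : 2 ≤ n) {a : ℝ}
    (ha : DiagOK P n a) :
    a ≠ 0 ∧ (p.phi n 0 = a ∧ p.phi 0 n ≠ a ∨ p.phi 0 n = a ∧ p.phi n 0 ≠ a) := by
  obtain ⟨ha0, -, -, -, hD⟩ := ha
  have hmem : ∀ l i, p.wcoeff (List.replicate n l) = a → A.var l i i ∈ diagVars P n a := by
    intro l i hl
    simp only [diagVars, Finset.mem_filter, Finset.mem_univ, true_and]
    exact ⟨A.L i i, by rw [h.one_diag hn, hl]⟩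
  refine ⟨ha0, ?_⟩
  rw [p.phi_zero_right, p.phi_zero_left]
  by_cases hX : p.wcoeff (List.replicate n 0) = a
  · refine Or.inl ⟨hX, fun hY => ?_⟩
    have hinj : Function.Injective fun e : Fin 2 × Fin k => A.var e.1 e.2 e.2 := by
      intro e e' he
      have := A.generic _ _ _ _ _ _ he
      exact Prod.ext this.1 this.2.1
    have hsub : Finset.univ.image (fun e : Fin 2 × Fin k => A.var e.1 e.2 e.2) ⊆
        diagVars P n a := by
      intro v hv
      obtain ⟨⟨l, i⟩, -, rfl⟩ := Finset.mem_image.1 hv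
      apply hmem
      fin_cases l
      · exact hX
      · exact hY
    have := Finset.card_le_card hsub
    rw [Finset.card_image_of_injective _ hinj, hD, Finset.card_univ, Fintype.card_prod,
      Fintype.card_fin, Fintype.card_fin] at this
    omega
  · refine Or.inr ⟨?_, hX⟩
    have hne : (diagVars P n a).Nonempty := by
      rw [← Finset.card_pos, hD]; exact hk
    obtain ⟨v, hv⟩ := hne
    simp only [diagVars, Finset.mem_filter, Finset.mem_univ, true_and] at hv
    obtain ⟨q, hq⟩ := hv
    obtain ⟨l, b, c, rfl⟩ := A.exists_var v
    obtain ⟨r, s, rfl⟩ := A.exists_L q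
    obtain ⟨rfl, rfl, rfl⟩ := h.diag_of_one_ne_zero hn (by rwa [hq])
    rw [h.one_diag hn] at hq
    fin_cases l
    · exact absurd hq hX
    · exact hq

theorem diagOK (h : IsNcRep P A p) {n : ℕ} (hn : 2 ≤ n) (h0 : p.phi n 0 ≠ 0)
    (h1 : p.phi 0 n ≠ 0) (h01 : p.phi n 0 ≠ p.phi 0 n) : DiagOK P n (p.phi n 0) := by
  classical
  have hX := p.phi_zero_right n
  have hY := p.phi_zero_left n
  have hval : ∀ l, p.wcoeff (List.replicate n l) = p.phi n 0 ↔ l = 0 := by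
    intro l
    fin_cases l
    · simp only [Fin.zero_eta, iff_true]; exact hX.symm
    · simp only [Fin.mk_one, one_ne_zero, iff_false]
      exact fun h' => h01 (h'.symm.trans hY.symm)
  have hval' : ∀ l, p.wcoeff (List.replicate n l) ≠ 0 := by
    intro l
    fin_cases l
    · exact fun h' => h0 (hX.trans h')
    · exact fun h' => h1 (hY.trans h')
  refine ⟨h0, ?_, ?_, ?_, ?_⟩
  · refine (Finset.card_le_card (t := {p.phi n 0, p.phi 0 n}) ?_).trans Finset.card_le_two
    intro x hx
    rw [oneCoeffs, Finset.mem_erase, Finset.mem_image] at hx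
    obtain ⟨hx0, ⟨q, v⟩, -, rfl⟩ := hx
    obtain ⟨l, b, c, rfl⟩ := A.exists_var v
    obtain ⟨r, s, rfl⟩ := A.exists_L q
    obtain ⟨rfl, rfl, rfl⟩ := h.diag_of_one_ne_zero hn hx0
    rw [h.one_diag hn, hX, hY, Finset.mem_insert, Finset.mem_singleton]
    fin_cases l
    · exact Or.inl rfl
    · exact Or.inr rfl
  · right
    have : ({e : Fin (k ^ 2) × Var k | one P n e.1 e.2 ≠ 0} : Finset _) =
        Finset.univ.image fun e : Fin 2 × Fin k => (A.L e.2 e.2, A.var e.1 e.2 e.2) := by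
      ext ⟨q, v⟩
      obtain ⟨l, b, c, rfl⟩ := A.exists_var v
      obtain ⟨r, s, rfl⟩ := A.exists_L q
      simp only [Finset.mem_filter, Finset.mem_univ, true_and, Finset.mem_image, Prod.exists,
        Prod.mk.injEq, A.L_eq_iff, A.generic.eq_iff]
      constructor
      · intro h'
        obtain ⟨rfl, rfl, rfl⟩ := h.diag_of_one_ne_zero hn h'
        exact ⟨l, s, ⟨rfl, rfl⟩, rfl, rfl, rfl⟩
      · rintro ⟨l, i, ⟨rfl, rfl⟩, rfl, rfl, rfl⟩
        rw [h.one_diag hn]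
        exact hval' l
    rw [this, Finset.card_image_of_injective, Finset.card_univ, Fintype.card_prod,
      Fintype.card_fin, Fintype.card_fin]
    intro e e' he
    have := A.generic _ _ _ _ _ _ (Prod.mk.inj he).2
    exact Prod.ext this.1 this.2.1
  · have : ({e : Fin (k ^ 2) × Var k | one P n e.1 e.2 = p.phi n 0} : Finset _) =
        Finset.univ.image fun i : Fin k => (A.L i i, A.var 0 i i) := by
      ext ⟨q, v⟩
      obtain ⟨l, b, c, rfl⟩ := A.exists_var v
      obtain ⟨r, s, rfl⟩ := A.exists_L q
      simp only [Finset.mem_filter, Finset.mem_univ, true_and, Finset.mem_image,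
        Prod.mk.injEq, A.L_eq_iff, A.generic.eq_iff]
      constructor
      · intro h'
        obtain ⟨rfl, rfl, rfl⟩ := h.diag_of_one_ne_zero hn (by rwa [h'])
        rw [h.one_diag hn, hval] at h'
        exact ⟨s, ⟨rfl, rfl⟩, h'.symm, rfl, rfl⟩
      · rintro ⟨i, ⟨rfl, rfl⟩, rfl, rfl, rfl⟩
        rw [h.one_diag hn, hval]
    rw [this, Finset.card_image_of_injective, Finset.card_univ, Fintype.card_fin]
    intro i i' he
    exact (A.generic _ _ _ _ _ _ (Prod.mk.inj he).2).2.1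
  · rw [h.diagVars_eq hn h0 h01.symm, A.card_xDiag]

/-! ## The test of DiagPar1 -/

/-- As `E² = 0`, the binomial expansion stops after the linear term. This is the origin of the
factor `n` in the test of DiagPar1. -/
theorem pow_scalar_add {R S : Type*} [CommSemiring R] [Semiring S] [Algebra R S] (x y : R) {E : S}
    (hE : E * E = 0) (n : ℕ) :
    (x • (1 : S) + y • E) ^ n = x ^ n • (1 : S) + (n * x ^ (n - 1) * y) • E := by
  induction n with
  | zero => simp
  | succ n ih =>
    rw [pow_succ, ih]
    rcases n with _ | n
    · simp
    · simp only [add_mul, mul_add, smul_mul_smul_comm, hE, one_mul, mul_one, smul_zero, add_zero,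
        Nat.add_sub_cancel, add_assoc, ← add_smul]
      congr 2
      · ring
      rw [show n + (1 + 1) - 1 = n + 1 from rfl]
      push_cast
      ring

/-- The matrix unit at `(b, c)`. -/
def unitMat (R : Type*) [CommSemiring R] (b c : Fin k) : Matrix (Fin k) (Fin k) R :=
  Matrix.of fun i j => if i = b ∧ j = c then 1 else 0

theorem unitMat_eq (R : Type*) [CommSemiring R] (b c : Fin k) :
    unitMat R b c = Matrix.single b c 1 := by
  ext i j
  simp [unitMat, Matrix.single_apply, eq_comm]

theorem unitMat_mul_self (R : Type*) [CommSemiring R] {b c : Fin k} (hbc : b ≠ c) :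
    unitMat R b c * unitMat R b c = 0 := by
  rw [unitMat_eq, Matrix.single_mul_single_of_ne _ _ _ _ hbc.symm]

theorem probe_eq (h : IsNcRep P A p) (n : ℕ) (D : Finset (Var k)) (u : Var k) (r s : Fin k) :
    probe P n D u (A.L r s) = (p.select {n}).eval
      (Matrix.of fun i j => if A.X i j ∈ D then MvPolynomial.X 0 else
        if A.X i j = u then MvPolynomial.X 1 else 0)
      (Matrix.of fun i j => if A.Y i j ∈ D then MvPolynomial.X 0 else
        if A.Y i j = u then MvPolynomial.X 1 else 0) r s := by
  classical
  rw [probe, h.apply, homogeneousComponent_genericEval, aeval_genericEval]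
  congr!

/-- The substitution sends `X` to `α I + β E_bc` and `Y` to `0`, so only the word `X^n` survives. -/
theorem probe_X (h : IsNcRep P A p) (n : ℕ) {b c : Fin k} (hbc : b ≠ c) (r s : Fin k) :
    probe P n A.xDiag (A.X b c) (A.L r s) =
      if r = s then MvPolynomial.C (p.phi n 0) * MvPolynomial.X 0 ^ n
      else if r = b ∧ s = c then
        MvPolynomial.C (n * p.phi n 0) * MvPolynomial.X 0 ^ (n - 1) * MvPolynomial.X 1
      else 0 := by
  have hX : (Matrix.of fun i j => if A.X i j ∈ A.xDiag then (MvPolynomial.X 0 :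
      MvPolynomial (Fin 2) ℝ) else if A.X i j = A.X b c then MvPolynomial.X 1 else 0) =
      (MvPolynomial.X 0 : MvPolynomial (Fin 2) ℝ) • 1 +
        (MvPolynomial.X 1 : MvPolynomial (Fin 2) ℝ) • unitMat _ b c := by
    ext1 i j
    simp only [← A.var_zero, A.var_mem_xDiag, A.generic.eq_iff, true_and, Matrix.of_apply,
      Matrix.add_apply, Matrix.smul_apply, Matrix.one_apply, unitMat, smul_eq_mul, mul_ite,
      mul_one, mul_zero]
    by_cases hij : i = j
    · subst hij
      have : ¬ (i = b ∧ i = c) := fun h' => hbc (h'.1.symm.trans h'.2)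
      simp [this]
    · simp [hij]
  have hY : (Matrix.of fun i j => if A.Y i j ∈ A.xDiag then (MvPolynomial.X 0 :
      MvPolynomial (Fin 2) ℝ) else if A.Y i j = A.X b c then MvPolynomial.X 1 else 0) = 0 := by
    ext1 i j
    simp [← A.var_zero, ← A.var_one, A.var_mem_xDiag, A.generic.eq_iff]
  rw [h.probe_eq, hX, hY, NcPoly.eval_select_of_commute (Commute.zero_right _),
    Finset.sum_eq_single 0]
  · rw [Nat.sub_zero, pow_zero, mul_one, pow_scalar_add _ _ (unitMat_mul_self _ hbc)]
    by_cases hrs : r = s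
    · subst hrs
      have : ¬ (r = b ∧ r = c) := fun h' => hbc (h'.1.symm.trans h'.2)
      simp [unitMat, this, MvPolynomial.smul_eq_C_mul]
    · by_cases h' : r = b ∧ s = c
      · simp [unitMat, h', hbc, MvPolynomial.smul_eq_C_mul]
        ring
      · simp [unitMat, h', hrs]
  · intro j _ hj
    simp [hj]
  · simp

theorem par1Test_X (h : IsNcRep P A p) {n : ℕ} (hn : 2 ≤ n) (h0 : p.phi n 0 ≠ 0) {b c : Fin k}
    (hbc : b ≠ c) : Par1Test P n (p.phi n 0) A.xDiag (A.X b c) := by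
  classical
  have hp := h.probe_X n hbc
  have hn0 : n ≠ 0 := by omega
  have hn1 : n - 1 ≠ 0 := by omega
  set F : MvPolynomial (Fin 2) ℝ := MvPolynomial.C (p.phi n 0) * MvPolynomial.X 0 ^ n with hF
  set G : MvPolynomial (Fin 2) ℝ :=
    MvPolynomial.C (n * p.phi n 0) * MvPolynomial.X 0 ^ (n - 1) * MvPolynomial.X 1 with hG
  -- Evaluation at `(1,0)` and `(1,1)` shows that `F`, `G` and `0` are distinct, so that the three
  -- classes of polynomials can be counted separately.
  have eF : MvPolynomial.eval ![1, 0] F = p.phi n 0 := by simp [hF]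
  have eG : MvPolynomial.eval ![1, 0] G = 0 := by simp [hG]
  have eG' : MvPolynomial.eval ![1, 1] G = n * p.phi n 0 := by simp [hG]
  have hF0 : F ≠ 0 := fun h' => h0 (by rw [← eF, h', map_zero])
  have hFG : F ≠ G := fun h' => h0 (by rw [← eF, h', eG])
  have hG0 : G ≠ 0 := fun h' => by
    have : (n : ℝ) * p.phi n 0 = 0 := by rw [← eG', h', map_zero]
    simp [hn0, h0] at this
  have sF : ({q | probe P n A.xDiag (A.X b c) q = F} : Finset (Fin (k ^ 2))) =
      Finset.univ.image fun i => A.L i i := by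
    ext q
    obtain ⟨r, s, rfl⟩ := A.exists_L q
    simp only [Finset.mem_filter, Finset.mem_univ, true_and, Finset.mem_image, hp, A.L_eq_iff]
    by_cases hrs : r = s
    · simp [hrs]
    · have : ¬ ∃ a, a = r ∧ a = s := by rintro ⟨a, rfl, rfl⟩; exact hrs rfl
      simp only [hrs, if_false, this, iff_false]
      split_ifs
      · exact hFG.symm
      · exact hF0.symm
  have sG : ({q | probe P n A.xDiag (A.X b c) q = G} : Finset (Fin (k ^ 2))) = {A.L b c} := by
    ext q
    obtain ⟨r, s, rfl⟩ := A.exists_L q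
    simp only [Finset.mem_filter, Finset.mem_univ, true_and, Finset.mem_singleton, hp, A.L_eq_iff]
    by_cases hrs : r = s
    · subst hrs
      simp only [if_true, hFG, false_iff]
      exact fun h' => hbc (h'.1.symm.trans h'.2)
    · simp only [hrs, if_false]
      split_ifs with h'
      · simp [h']
      · simp [h', hG0.symm]
  have cF : Finset.card {q | probe P n A.xDiag (A.X b c) q = F} = k := by
    rw [sF, Finset.card_image_of_injective, Finset.card_univ, Fintype.card_fin]
    intro i j hij
    exact (A.L_eq_iff.1 hij).1
  have cG : Finset.card {q | probe P n A.xDiag (A.X b c) q = G} = 1 := by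
    rw [sG, Finset.card_singleton]
  refine ⟨cF, cG, ?_⟩
  have hU : (Finset.univ : Finset (Fin (k ^ 2))) =
      (({q | probe P n A.xDiag (A.X b c) q = 0} : Finset (Fin (k ^ 2))) ∪
        ({q | probe P n A.xDiag (A.X b c) q = F} : Finset (Fin (k ^ 2)))) ∪
        ({q | probe P n A.xDiag (A.X b c) q = G} : Finset (Fin (k ^ 2))) := by
    ext q
    obtain ⟨r, s, rfl⟩ := A.exists_L q
    simp only [Finset.mem_union, Finset.mem_filter, Finset.mem_univ, true_and, true_iff, hp]
    split_ifs <;> simp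
  have hc := congrArg Finset.card hU
  rw [Finset.card_union_of_disjoint, Finset.card_union_of_disjoint, cF, cG, Finset.card_univ,
    Fintype.card_fin] at hc
  · exact hc.symm
  · rw [Finset.disjoint_filter]
    intro q _ h1 h2
    exact hF0 (h2.symm.trans h1)
  · rw [Finset.disjoint_union_left, Finset.disjoint_filter, Finset.disjoint_filter]
    exact ⟨fun q _ h1 h2 => hG0 (h2.symm.trans h1), fun q _ h1 h2 => hFG (h1.symm.trans h2)⟩

/-- Values of the probes of the variables of `Y`. -/
theorem eval_probe_Y (h : IsNcRep P A p) (n : ℕ) (b c r s : Fin k) (x y : ℝ) :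
    MvPolynomial.aeval ![x, y] (probe P n A.xDiag (A.Y b c) (A.L r s)) =
      ∑ j ∈ Finset.range (n + 1),
        p.phi (n - j) j * (x ^ (n - j) * y ^ j * (unitMat ℝ b c ^ j) r s) := by
  have hX : (MvPolynomial.aeval (R := ℝ) ![x, y]).mapMatrix (Matrix.of fun i j =>
      if A.X i j ∈ A.xDiag then (MvPolynomial.X 0 :
      MvPolynomial (Fin 2) ℝ) else if A.X i j = A.Y b c then MvPolynomial.X 1 else 0) =
      x • (1 : Matrix (Fin k) (Fin k) ℝ) := by
    ext1 i j
    simp only [AlgHom.mapMatrix_apply, Matrix.map_apply, ← A.var_zero, ← A.var_one,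
      A.var_mem_xDiag, A.generic.eq_iff, true_and, Matrix.of_apply, Matrix.smul_apply,
      Matrix.one_apply]
    by_cases hij : i = j <;> simp [hij]
  have hY : (MvPolynomial.aeval (R := ℝ) ![x, y]).mapMatrix (Matrix.of fun i j =>
      if A.Y i j ∈ A.xDiag then (MvPolynomial.X 0 :
      MvPolynomial (Fin 2) ℝ) else if A.Y i j = A.Y b c then MvPolynomial.X 1 else 0) =
      y • unitMat ℝ b c := by
    ext1 i j
    simp only [AlgHom.mapMatrix_apply, Matrix.map_apply, ← A.var_one,
      A.var_mem_xDiag, A.generic.eq_iff, true_and, Matrix.of_apply, Matrix.smul_apply, unitMat]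
    by_cases hij : i = b ∧ j = c <;> simp [hij]
  have h1 := NcPoly.map_eval (MvPolynomial.aeval (R := ℝ) ![x, y]).mapMatrix
    (Matrix.of fun i j => if A.X i j ∈ A.xDiag then (MvPolynomial.X 0 :
      MvPolynomial (Fin 2) ℝ) else if A.X i j = A.Y b c then MvPolynomial.X 1 else 0)
    (Matrix.of fun i j => if A.Y i j ∈ A.xDiag then (MvPolynomial.X 0 :
      MvPolynomial (Fin 2) ℝ) else if A.Y i j = A.Y b c then MvPolynomial.X 1 else 0)
    (p.select {n})
  have hcomm : Commute (x • (1 : Matrix (Fin k) (Fin k) ℝ)) (y • unitMat ℝ b c) := by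
    rw [Commute, SemiconjBy, smul_mul_smul_comm, smul_mul_smul_comm, one_mul, mul_one, mul_comm x y]
  rw [hX, hY, NcPoly.eval_select_of_commute hcomm] at h1
  rw [h.probe_eq]
  have h2 := congrFun (congrFun h1 r) s
  rw [AlgHom.mapMatrix_apply, Matrix.map_apply] at h2
  rw [h2, Matrix.sum_apply]
  refine Finset.sum_congr rfl fun j _ => ?_
  rw [smul_pow, smul_pow, one_pow, smul_mul_smul_comm, one_mul, Matrix.smul_apply,
    Matrix.smul_apply, smul_eq_mul, smul_eq_mul]

/-- For `b = c`, the polynomial at `(b,b)` retains the term `φ(0,n) β^n`, so at most `k - 1`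
polynomials equal `a α^n`. For `b ≠ c`, the matrix unit squares to zero and the only off-diagonal
value is `φ(n-1,1) α^(n-1) β`, which is not the required one. -/
theorem not_par1Test_Y (h : IsNcRep P A p) {n : ℕ} (hn : 2 ≤ n) (h0 : p.phi n 0 ≠ 0)
    (h1 : p.phi 0 n ≠ 0) (hc : (n : ℝ) * p.phi n 0 ≠ p.phi (n - 1) 1) (b c : Fin k) :
    ¬ Par1Test P n (p.phi n 0) A.xDiag (A.Y b c) := by
  classical
  rintro ⟨cF, cG, -⟩
  -- Setting `β = 0` leaves only `X^n` at the identity, which tells diagonal positions from the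
  -- others.
  have e10 : ∀ r s, MvPolynomial.aeval ![(1 : ℝ), 0] (probe P n A.xDiag (A.Y b c) (A.L r s)) =
      if r = s then p.phi n 0 else 0 := by
    intro r s
    rw [h.eval_probe_Y, Finset.sum_eq_single 0]
    · simp [Matrix.one_apply]
    · intro j _ hj
      simp [hj]
    · simp
  by_cases hbc : b = c
  · subst hbc
    have e01 : MvPolynomial.aeval ![(0 : ℝ), 1] (probe P n A.xDiag (A.Y b b) (A.L b b)) =
        p.phi 0 n := by
      rw [h.eval_probe_Y, Finset.sum_eq_single n]
      · have : ∀ m, (unitMat ℝ b b ^ m) b b = 1 := by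
          intro m
          have : unitMat ℝ b b = Matrix.diagonal fun i => if i = b then 1 else 0 := by
            ext i j
            by_cases hij : i = j
            · subst hij; simp [unitMat]
            · simp only [unitMat, Matrix.of_apply, Matrix.diagonal_apply_ne _ hij]
              rw [if_neg]
              rintro ⟨rfl, rfl⟩
              exact hij rfl
          rw [this, Matrix.diagonal_pow]
          simp
        simp [this]
      · intro j hj hj'
        rw [Finset.mem_range] at hj
        rw [zero_pow (by omega)]
        ring
      · simp
    have hsub : ({q | probe P n A.xDiag (A.Y b b) q = MvPolynomial.C (p.phi n 0) *
        MvPolynomial.X 0 ^ n} : Finset (Fin (k ^ 2))) ⊆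
        (Finset.univ.erase b).image fun i => A.L i i := by
      intro q hq
      obtain ⟨r, s, rfl⟩ := A.exists_L q
      simp only [Finset.mem_filter, Finset.mem_univ, true_and] at hq
      have h2 := e10 r s
      rw [hq] at h2
      by_cases hrs : r = s
      · subst hrs
        refine Finset.mem_image.2 ⟨r, Finset.mem_erase.2 ⟨?_, Finset.mem_univ _⟩, rfl⟩
        rintro rfl
        rw [hq] at e01
        simp [show n ≠ 0 by omega] at e01
        exact h1 e01.symm
      · simp [hrs, h0] at h2
    have h3 := (Finset.card_le_card hsub).trans Finset.card_image_le
    rw [cF, Finset.card_erase_of_mem (Finset.mem_univ _), Finset.card_univ, Fintype.card_fin] at h3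
    have := b.pos
    omega
  · obtain ⟨q, hq⟩ := Finset.card_eq_one.1 cG
    have hq : q ∈ ({q | probe P n A.xDiag (A.Y b c) q = MvPolynomial.C (n * p.phi n 0) *
        MvPolynomial.X 0 ^ (n - 1) * MvPolynomial.X 1} : Finset (Fin (k ^ 2))) := by
      rw [hq]; simp
    obtain ⟨r, s, rfl⟩ := A.exists_L q
    simp only [Finset.mem_filter, Finset.mem_univ, true_and] at hq
    have h2 := e10 r s
    have h3 := h.eval_probe_Y n b c r s 1 1
    have hsum : ∑ j ∈ Finset.range (n + 1),
        p.phi (n - j) j * ((1 : ℝ) ^ (n - j) * 1 ^ j * (unitMat ℝ b c ^ j) r s) =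
        (if r = s then p.phi n 0 else 0) + if r = b ∧ s = c then p.phi (n - 1) 1 else 0 := by
      rw [← Finset.sum_subset (s₁ := Finset.range 2)]
      · simp [Finset.sum_range_succ, Matrix.one_apply, unitMat]
      · exact Finset.range_subset_range.2 (by omega)
      · intro j _ hj
        obtain ⟨j, rfl⟩ := Nat.exists_eq_add_of_le' (not_lt.1 (Finset.mem_range.not.1 hj))
        simp [pow_add, sq, unitMat_mul_self ℝ hbc]
    rw [hsum, hq] at h3
    rw [hq] at h2
    have hn0 : (n : ℝ) * p.phi n 0 ≠ 0 := mul_ne_zero (by simp; omega) h0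
    simp only [map_mul, map_pow, MvPolynomial.aeval_X, MvPolynomial.aeval_C, Matrix.cons_val_zero,
      Matrix.cons_val_one, one_pow, mul_one, mul_zero] at h2 h3
    -- By `h2` the diagonal contribution is zero, so the value at `(1,1)` is `φ(n-1,1)` or `0`;
    -- neither is `n φ(n,0)`.
    rw [← h2, zero_add] at h3
    split_ifs at h3
    · exact hc h3
    · exact hn0 h3

/-! ## The test of DiagPar2 -/

/-- Every diagonal polynomial contains some `x_rr^n`, with the nonzero coefficient `φ(n,0)`. -/
theorem exists_of_offdiag (h : IsNcRep P A p) {n : ℕ} (hn : 2 ≤ n) (h0 : p.phi n 0 ≠ 0)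
    {q : Fin (k ^ 2)} (hq : ∀ w, one P n q w = 0) : ∃ r s, r ≠ s ∧ A.L r s = q := by
  obtain ⟨r, s, rfl⟩ := A.exists_L q
  refine ⟨r, s, ?_, rfl⟩
  rintro rfl
  have := hq (A.var 0 r r)
  rw [h.one_diag hn] at this
  exact h0 ((p.phi_zero_right n).trans this)

/-- Consider the test at `x_ii` in the polynomial at `(r,s)`, `r ≠ s`. If `i` is `r` or `s`, then
`x_rs` also has the coefficient `a`, so no variable of `Y` is the only one. Otherwise no walk from
`r` to `s` can combine loops at `i` with one further edge, and the coefficient is zero. -/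
theorem not_par2Test_Y (h : IsNcRep P A p) {n : ℕ} (hn : 2 ≤ n) (h0 : p.phi n 0 ≠ 0)
    (b c : Fin k) : ¬ Par2Test P n (p.phi n 0) A.xDiag (A.Y b c) := by
  rintro ⟨v, hv, q, hq, hw⟩
  obtain ⟨i, -, rfl⟩ := Finset.mem_image.1 hv
  obtain ⟨r, s, hrs, rfl⟩ := h.exists_of_offdiag hn h0 hq
  have hXY : ∀ b' c', A.X b' c' ≠ A.Y b c := fun b' c' h' => by
    simpa using A.generic 0 b' c' 1 b c h'
  by_cases hi : i = r ∨ i = s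
  · refine hXY r s ((hw (A.X r s)).1 ⟨?_, ?_⟩)
    · intro h'
      have := A.generic 0 _ _ 0 _ _ h'
      exact hrs (this.2.1.trans this.2.2.symm)
    · rw [h.two_X hn _ _ _ hrs, if_pos ⟨⟨rfl, rfl⟩, hi⟩]
  · obtain ⟨-, h2⟩ := (hw (A.Y b c)).2 rfl
    by_cases hbc : b = c
    · subst hbc
      rw [← A.var_one, h.two_diag hrs (fun h' => hXY _ _ h'.symm)] at h2
      exact h0 h2.symm
    · rw [← A.var_one, h.two_offdiag hn _ _ _ _ hbc] at h2
      split_ifs at h2 with h3 h4 h5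
      · exact hi (Or.inl (h4.trans h3.1.symm))
      · exact hi (Or.inr (h5.trans h3.2.symm))
      · exact h0 h2.symm
      · exact h0 h2.symm

/-- In the polynomial at `(b,c)` the only possible rival of `x_bc` is `y_bc`. Its coefficient is
`φ(n-1,1;Y)` when tested with `x_bb` and `φ(Y;n-1,1)` when tested with `x_cc`; it suffices that one
of these differs from `φ(n,0)`. -/
theorem par2Test_X (h : IsNcRep P A p) {n : ℕ} (hn : 2 ≤ n) (h0 : p.phi n 0 ≠ 0)
    (hc : p.phi n 0 ≠ p.phiEnd (n - 1) 1 1 ∨ p.phi n 0 ≠ p.phiStart 1 (n - 1) 1)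
    {b c : Fin k} (hbc : b ≠ c) : Par2Test P n (p.phi n 0) A.xDiag (A.X b c) := by
  have hq : ∀ w, one P n (A.L b c) w = 0 := by
    intro w
    obtain ⟨l, r, s, rfl⟩ := A.exists_var w
    rw [h.one_eq hn, if_neg]
    rintro ⟨rfl, rfl, rfl⟩
    exact hbc rfl
  have key : ∀ i, (i = b ∨ i = c) →
      two P n (A.L b c) (A.X i i) (A.Y b c) ≠ p.phi n 0 →
      Par2Test P n (p.phi n 0) A.xDiag (A.X b c) := by
    intro i hi hY
    refine ⟨A.X i i, Finset.mem_image.2 ⟨i, Finset.mem_univ _, rfl⟩, A.L b c, hq, fun w => ?_⟩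
    constructor
    · rintro ⟨hw, h2⟩
      obtain ⟨l, r, s, rfl⟩ := A.exists_var w
      by_cases hrs : r = s
      · subst hrs
        rw [h.two_diag hbc hw] at h2
        exact absurd h2.symm h0
      · have h3 : b = r ∧ c = s := by
          rw [h.two_offdiag hn _ _ _ _ hrs] at h2
          by_contra hne
          rw [if_neg hne] at h2
          exact h0 h2.symm
        obtain ⟨rfl, rfl⟩ := h3
        fin_cases l
        · rfl
        · exact absurd h2 hY
    · rintro rfl
      refine ⟨?_, ?_⟩
      · intro h'
        have := A.generic 0 _ _ 0 _ _ h'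
        exact hbc (this.2.1.trans this.2.2.symm)
      · rw [h.two_X hn _ _ _ hbc, if_pos ⟨⟨rfl, rfl⟩, hi⟩]
  rcases hc with hc | hc
  · refine key b (Or.inl rfl) ?_
    rw [← A.var_one, h.two_offdiag hn _ _ _ _ hbc, if_pos ⟨rfl, rfl⟩, if_pos rfl]
    rw [p.phiEnd_one] at hc
    exact hc.symm
  · refine key c (Or.inr rfl) ?_
    rw [← A.var_one, h.two_offdiag hn _ _ _ _ hbc, if_pos ⟨rfl, rfl⟩, if_neg hbc.symm, if_pos rfl]
    rw [p.phiStart_one] at hc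
    exact hc.symm

end IsNcRep

/-! ## The partition of the variables -/

/-- A test without false negatives gives a superset of the variables of `X`, and one without false
positives gives a subset. Either way equal cardinality forces equality, so one-sided reliability is
enough once the step has not failed. -/
theorem partition_eq_xSet {T : Var k → Prop} {S : Finset (Var k)}
    (hT : (∀ b c, b ≠ c → T (A.X b c)) ∨ ∀ b c, ¬ T (A.Y b c))
    (hS : partition A.xDiag T = some S) : S = A.xSet := by
  classical
  simp only [partition, Option.ite_none_right_eq_some, Option.some.injEq] at hS
  obtain ⟨hcard, rfl⟩ := hS
  replace hcard := hcard.trans A.card_xSet.symm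
  rcases hT with hT | hT
  · refine (Finset.eq_of_subset_of_card_le ?_ hcard.le).symm
    intro v hv
    obtain ⟨l, i, j, rfl⟩ := A.exists_var v
    obtain rfl := A.var_mem_xSet.1 hv
    by_cases hij : i = j
    · exact Finset.mem_union_left _ (A.var_mem_xDiag.2 ⟨rfl, hij⟩)
    · refine Finset.mem_union_right _ (Finset.mem_filter.2 ⟨Finset.mem_univ _, ?_, hT i j hij⟩)
      exact fun h => hij (A.var_mem_xDiag.1 h).2
  · refine Finset.eq_of_subset_of_card_le ?_ hcard.ge
    intro v hv
    rcases Finset.mem_union.1 hv with hv | hv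
    · exact A.xDiag_subset_xSet hv
    · obtain ⟨l, i, j, rfl⟩ := A.exists_var v
      rw [A.var_mem_xSet]
      fin_cases l
      · rfl
      · exact absurd (Finset.mem_filter.1 hv).2.2 (hT i j)

theorem partition_of_test {T : Var k → Prop} (hT : ∀ b c, b ≠ c → T (A.X b c))
    (hT' : ∀ b c, ¬ T (A.Y b c)) : partition A.xDiag T = some A.xSet := by
  classical
  have : A.xDiag ∪ ({u | u ∉ A.xDiag ∧ T u} : Finset (Var k)) = A.xSet := by
    ext v
    obtain ⟨l, i, j, rfl⟩ := A.exists_var v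
    simp only [Finset.mem_union, Finset.mem_filter, Finset.mem_univ, true_and, A.var_mem_xDiag,
      A.var_mem_xSet]
    fin_cases l
    · by_cases hij : i = j
      · simp [hij]
      · simpa [hij, A.var_zero] using hT i j hij
    · simpa [A.var_one] using hT' i j
  simp only [partition]
  rw [if_pos]
  · congr!
  · convert A.card_xSet

/-! ## The positioning steps -/

theorem fill_eq_some_of_iff {ι α : Type*} {R : ι → α → Prop} {f : ι → α}
    (h : ∀ i u, R i u ↔ u = f i) : fill R = some f := by
  have hu : ∀ i, ∃! u, R i u := fun i => ⟨f i, (h i _).2 rfl, fun u hu => (h i u).1 hu⟩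
  rw [fill, dif_pos hu]
  congr
  funext i
  exact (h i _).1 (hu i).choose_spec.1

theorem fill_eq_none {ι α : Type*} {R : ι → α → Prop} (i : ι) (h : ∀ u, ¬ R i u) :
    fill R = none := by
  rw [fill, dif_neg]
  intro h'
  obtain ⟨u, hu, -⟩ := h' i
  exact h u hu

/-- The arrangement agrees with the choices that the algorithms make. -/
def Arrangement.Normalized (A : Arrangement k) (c : TieBreak k) (P : Family k) (n : ℕ) (a : ℝ) :
    Prop :=
  c.order A.xDiag = (fun i => A.X i i) ∧
  ∀ i j : Fin k, i.val = 0 → j.val = 1 →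
    c.pick (rowCol P n a A.xDiag A.xSet (A.X i i) ∩ rowCol P n a A.xDiag A.xSet (A.X j j)) = A.X i j

namespace IsNcRep

/-- A loop at `i` can be combined with the edge `b → c` only if `i` is one of its ends. Two such
crosses, for `i ≠ j`, meet in `x_ij` and `x_ji`. -/
theorem mem_rowCol (h : IsNcRep P A p) {n : ℕ} (hn : 2 ≤ n) (h0 : p.phi n 0 ≠ 0) (i : Fin k)
    (u : Var k) : u ∈ rowCol P n (p.phi n 0) A.xDiag A.xSet (A.X i i) ↔
      ∃ b c, u = A.X b c ∧ b ≠ c ∧ (i = b ∨ i = c) := by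
  obtain ⟨l, b, c, rfl⟩ := A.exists_var u
  simp only [rowCol, Finset.mem_filter, Finset.mem_univ, true_and, A.var_mem_xSet, A.var_mem_xDiag]
  constructor
  · rintro ⟨rfl, hbc, q, hq⟩
    have hbc : b ≠ c := fun h' => hbc ⟨rfl, h'⟩
    refine ⟨b, c, rfl, hbc, ?_⟩
    obtain ⟨r, s, rfl⟩ := A.exists_L q
    rw [A.var_zero, h.two_X hn _ _ _ hbc] at hq
    by_contra hi
    rw [if_neg (fun h' => hi h'.2)] at hq
    exact h0 hq.symm
  · rintro ⟨b', c', hu, hbc, hi⟩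
    obtain ⟨rfl, rfl, rfl⟩ := A.generic l b c 0 b' c' hu
    exact ⟨rfl, fun h' => hbc h'.2, A.L b c, by
      rw [A.var_zero, h.two_X hn _ _ _ hbc, if_pos ⟨⟨rfl, rfl⟩, hi⟩]⟩

theorem mem_rowCol_inter (h : IsNcRep P A p) {n : ℕ} (hn : 2 ≤ n) (h0 : p.phi n 0 ≠ 0)
    {i j : Fin k} (hij : i ≠ j) (u : Var k) :
    u ∈ rowCol P n (p.phi n 0) A.xDiag A.xSet (A.X i i) ∩
      rowCol P n (p.phi n 0) A.xDiag A.xSet (A.X j j) ↔ u = A.X i j ∨ u = A.X j i := by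
  rw [Finset.mem_inter, h.mem_rowCol hn h0, h.mem_rowCol hn h0]
  constructor
  · rintro ⟨⟨b, c, rfl, hbc, hi⟩, b', c', hu, -, hj⟩
    obtain ⟨-, rfl, rfl⟩ := A.generic 0 _ _ 0 _ _ hu
    rcases hi with rfl | rfl <;> rcases hj with rfl | rfl
    · exact absurd rfl hij
    · exact Or.inl rfl
    · exact Or.inr rfl
    · exact absurd rfl hij
  · rintro (rfl | rfl)
    · exact ⟨⟨i, j, rfl, hij, Or.inl rfl⟩, i, j, rfl, hij, Or.inr rfl⟩
    · exact ⟨⟨j, i, rfl, hij.symm, Or.inr rfl⟩, j, i, rfl, hij.symm, Or.inl rfl⟩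

/-- This identifies the position of a polynomial, and includes `i = j`, where the word is `x_ii^n`.
-/
theorem two_X_eq (h : IsNcRep P A p) {n : ℕ} (hn : 2 ≤ n) (h0 : p.phi n 0 ≠ 0) {i j : Fin k}
    (q : Fin (k ^ 2)) : two P n q (A.X i i) (A.X i j) = p.phi n 0 ↔ q = A.L i j := by
  obtain ⟨r, s, rfl⟩ := A.exists_L q
  rw [A.L_eq_iff]
  by_cases hij : i = j
  · subst hij
    rw [h.two_X_diag hn]
    simp [h0.symm]
  · rw [h.two_X hn _ _ _ hij]
    simp [h0.symm]

/-- A step of ParPosX along a row, read backwards. -/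
theorem eq_of_three (h : IsNcRep P A p) {n : ℕ} (hn : 2 ≤ n) (h0 : p.phi n 0 ≠ 0)
    {i r j : Fin k} (hir : i ≠ r) (hji : j ≠ i) (hjr : j ≠ r) {s m : Var k} {q : Fin (k ^ 2)}
    (hq : two P n q (A.X i i) (A.X i r) = p.phi n 0)
    (hs : s ∈ rowCol P n (p.phi n 0) A.xDiag A.xSet (A.X i i) ∩
      rowCol P n (p.phi n 0) A.xDiag A.xSet (A.X j j))
    (hm : m ∈ rowCol P n (p.phi n 0) A.xDiag A.xSet (A.X j j) ∩
      rowCol P n (p.phi n 0) A.xDiag A.xSet (A.X r r))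
    (h3 : three P n q (A.X i i) s m = p.phi n 0) : s = A.X i j ∧ m = A.X j r := by
  rw [h.two_X_eq hn h0] at hq
  subst hq
  rw [h.mem_rowCol_inter hn h0 hji.symm] at hs
  rw [h.mem_rowCol_inter hn h0 hjr] at hm
  have key := h.three_X hn hir hji hjr
  rcases hs with rfl | rfl <;> rcases hm with rfl | rfl
  · exact ⟨rfl, rfl⟩
  · have := key true false
    simp only [if_true, Bool.false_eq_true, if_false, and_false] at this
    exact absurd (h3.symm.trans this) h0
  · have := key false true
    simp only [if_true, Bool.false_eq_true, if_false, false_and] at this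
    exact absurd (h3.symm.trans this) h0
  · have := key false false
    simp only [Bool.false_eq_true, if_false, and_false] at this
    exact absurd (h3.symm.trans this) h0

/-- No rule misplaces a variable, by induction on the placements. All positions are reached: the
seed and the row rule fill the first row, interchange gives the first column, and the column rule
applied to `(0,j)` with intermediate index `i` gives `(i,j)`. -/
theorem placed_iff (h : IsNcRep P A p) {n : ℕ} (hn : 2 ≤ n) (h0 : p.phi n 0 ≠ 0) {c : TieBreak k}
    (hA : A.Normalized c P n (p.phi n 0)) (u : Var k) (i j : Fin k) :
    Placed c P n (p.phi n 0) A.xDiag A.xSet (c.order A.xDiag) u i j ↔ u = A.X i j := by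
  rw [hA.1]
  constructor
  · intro hu
    induction hu with
    | diag i => rfl
    | seed i j hi hj hne => exact hA.2 i j hi hj
    | swap i j u w hij _ hw hwu ih =>
      subst ih
      rw [h.mem_rowCol_inter hn h0 hij] at hw
      exact hw.resolve_left hwu
    | row i r j u s m q hir hji hjr _ hq _ hs hm h3 ih =>
      subst ih
      exact (h.eq_of_three hn h0 hir hji hjr hq hs hm h3).1
    | col i r j u s m q hir hji hjr _ hq _ hs hm h3 ih =>
      subst ih
      exact (h.eq_of_three hn h0 hir hji hjr hq hs hm h3).2
  · rintro rfl
    set Pl := Placed c P n (p.phi n 0) A.xDiag A.xSet (fun i => A.X i i) with hPl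
    have hswap : ∀ i j, i ≠ j → Pl (A.X i j) i j → Pl (A.X j i) j i := by
      intro i j hij hP
      refine Placed.swap i j _ _ hij hP ?_ ?_
      · rw [h.mem_rowCol_inter hn h0 hij]
        exact Or.inr rfl
      · intro h'
        have := A.generic 0 _ _ 0 _ _ h'
        exact hij this.2.2
    have hstep : ∀ i r j, i ≠ r → j ≠ i → j ≠ r → Pl (A.X i r) i r →
        Pl (A.X i j) i j ∧ Pl (A.X j r) j r := by
      intro i r j hir hji hjr hP
      have hq : two P n (A.L i r) (A.X i i) (A.X i r) = p.phi n 0 := (h.two_X_eq hn h0 _).2 rfl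
      have hq' : two P n (A.L i r) (A.X r r) (A.X i r) = p.phi n 0 := by
        rw [h.two_X hn _ _ _ hir, if_pos ⟨⟨rfl, rfl⟩, Or.inr rfl⟩]
      have hs := (h.mem_rowCol_inter hn h0 hji.symm (A.X i j)).2 (Or.inl rfl)
      have hm := (h.mem_rowCol_inter hn h0 hjr (A.X j r)).2 (Or.inl rfl)
      have h3 : three P n (A.L i r) (A.X i i) (A.X i j) (A.X j r) = p.phi n 0 := by
        simpa using h.three_X hn hir hji hjr true true
      exact ⟨Placed.row i r j _ _ _ _ hir hji hjr hP hq hq' hs hm h3,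
        Placed.col i r j _ _ _ _ hir hji hjr hP hq hq' hs hm h3⟩
    by_cases hij : i = j
    · subst hij
      exact Placed.diag i
    · have hk : 1 < k := by
        have := i.isLt; have := j.isLt
        have := Fin.val_ne_of_ne hij
        omega
      obtain ⟨z, hz⟩ : ∃ z : Fin k, z.val = 0 := ⟨⟨0, by omega⟩, rfl⟩
      obtain ⟨o, ho⟩ : ∃ o : Fin k, o.val = 1 := ⟨⟨1, hk⟩, rfl⟩
      have hzo : z ≠ o := fun h' => by rw [h', ho] at hz; exact absurd hz (by norm_num)
      have hseed : Pl (A.X z o) z o := by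
        rw [← hA.2 z o hz ho]
        refine Placed.seed z o hz ho ⟨A.X z o, ?_⟩
        rw [h.mem_rowCol_inter hn h0 hzo]
        exact Or.inl rfl
      have hrow : ∀ r, z ≠ r → Pl (A.X z r) z r := by
        intro r hr
        by_cases hro : r = o
        · subst hro; exact hseed
        · exact (hstep z o r hzo hr.symm hro hseed).1
      by_cases hi : i = z
      · subst hi; exact hrow j hij
      · by_cases hj : j = z
        · subst hj; exact hswap _ _ (Ne.symm hi) (hrow i (Ne.symm hi))
        · exact (hstep z j i (Ne.symm hj) hi hij (hrow j (Ne.symm hj))).2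

theorem parPosX_eq (h : IsNcRep P A p) {n : ℕ} (hn : 2 ≤ n) (h0 : p.phi n 0 ≠ 0) {c : TieBreak k}
    (hA : A.Normalized c P n (p.phi n 0)) :
    parPosX c P n (p.phi n 0) A.xDiag A.xSet = some fun e => A.X e.1 e.2 :=
  fill_eq_some_of_iff fun e u => h.placed_iff hn h0 hA u e.1 e.2

theorem posPol_eq (h : IsNcRep P A p) {n : ℕ} (hn : 2 ≤ n) (h0 : p.phi n 0 ≠ 0) :
    posPol P n (p.phi n 0) (fun e => A.X e.1 e.2) = some fun e => A.L e.1 e.2 :=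
  fill_eq_some_of_iff fun _ q => h.two_X_eq hn h0 q

/-- The degree `t` part is a nonzero multiple of `(Y^t)_ii`, where a pure power can only come from
the loop at `i`. -/
theorem specialize_diag_iff (h : IsNcRep P A p) {m t : ℕ} (htm : t ≤ m) (ht : 1 ≤ t)
    (hφ : p.phi (m - t) t ≠ 0) (i : Fin k) (u : Var k) :
    (u ∉ A.xSet ∧ MvPolynomial.coeff (Finsupp.single u t)
      (specialize P A.xDiag A.xSet m (A.L i i)) ≠ 0) ↔ u = A.Y i i := by
  obtain ⟨l, b, c, rfl⟩ := A.exists_var u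
  rw [A.var_mem_xSet, h.coeff_specialize htm _ _ _ (by simp), ← A.var_one, A.generic.eq_iff,
    mul_ne_zero_iff, and_iff_right hφ]
  have ht0 : t ≠ 0 := by omega
  fin_cases l
  · simp
  · simp only [Fin.mk_one, one_ne_zero, not_false_eq_true, true_and, ne_eq]
    by_cases hbc : b = c
    · subst hbc
      rw [wordCoeff_pow A.generic]
      simp [ht0, eq_comm]
    · have hno : ¬ (b = i ∧ c = i) := fun h' => hbc (h'.1.trans h'.2.symm)
      simp only [hno, iff_false, not_not]
      -- For `t = 1` an off-diagonal variable does occur as a first power in the family, but only in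
      -- its own position and hence not in `(i,i)`.
      rcases Nat.lt_or_ge 1 t with h1 | h1
      · exact wordCoeff_pow_offdiag A.generic 1 hbc _ h1 i i
      · obtain rfl : t = 1 := le_antisymm h1 ht
        have := wordCoeff_two_offdiag A.generic 1 1 i hbc (List.replicate 1 1) 0 i i
        rw [Finsupp.single_zero, zero_add] at this
        rw [this, if_neg]
        rintro ⟨rfl, rfl, _⟩
        exact hbc rfl

/-- A walk from `i` to `j` with `t - 1` loops at `i` and one further edge must have `i → j` as that
edge. -/
theorem specialize_iff (h : IsNcRep P A p) {m t : ℕ} (htm : t ≤ m) (ht : 1 ≤ t)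
    (hφ : p.phi (m - t) t ≠ 0) (i j : Fin k) (u : Var k) :
    (u ∉ A.xSet ∧ MvPolynomial.coeff (Finsupp.single (A.Y i i) (t - 1) + Finsupp.single u 1)
      (specialize P A.xDiag A.xSet m (A.L i j)) ≠ 0) ↔ u = A.Y i j := by
  obtain ⟨l, b, c, rfl⟩ := A.exists_var u
  rw [A.var_mem_xSet, h.coeff_specialize htm _ _ _
    (by rw [map_add, Finsupp.degree_single, Finsupp.degree_single]; omega), ← A.var_one, ← A.var_one,
    A.generic.eq_iff, mul_ne_zero_iff, and_iff_right hφ]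
  obtain ⟨N, rfl⟩ := Nat.exists_eq_add_of_le' ht
  rw [Nat.add_sub_cancel]
  fin_cases l
  · simp
  · simp only [Fin.mk_one, one_ne_zero, not_false_eq_true, true_and, ne_eq]
    by_cases hbc : b = c
    · subst hbc
      by_cases hib : i = b
      · subst hib
        rw [← Finsupp.single_add, wordCoeff_pow A.generic]
        simp
      · have hno : ¬ (b = i ∧ b = j) := fun h' => hib h'.1.symm
        simp only [hno, iff_false, not_not]
        by_cases hN : N = 0
        · subst hN
          simp only [Finsupp.single_zero, zero_add]
          rw [wordCoeff_pow A.generic, if_neg]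
          rintro ⟨_, _, h'⟩
          exact h'.elim (by simp) hib
        · exact wordCoeff_two_diag A.generic 1 1 i b (fun h' => hib h'.2) _ _ _ _ (Or.inr ⟨hib, hN⟩)
    · rw [wordCoeff_two_offdiag A.generic 1 1 i hbc]
      have hrep : List.replicate (N + 1) (1 : Fin 2) = List.replicate N 1 ++ [1] :=
        List.replicate_succ'
      by_cases hib : i = b
      · subst hib
        simp [hrep, eq_comm]
      · have hno : ¬ (b = i ∧ c = j) := fun h' => hib h'.1.symm
        simp [hib, hno]

theorem posYAt_eq (h : IsNcRep P A p) {m t : ℕ} (htm : t ≤ m) (ht : 1 ≤ t)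
    (hφ : p.phi (m - t) t ≠ 0) :
    posYAt P A.xDiag A.xSet (fun e => A.L e.1 e.2) m t = some fun e => A.Y e.1 e.2 := by
  rw [posYAt, fill_eq_some_of_iff (f := fun i => A.Y i i)
    fun i u => h.specialize_diag_iff htm ht hφ i u, Option.bind_some]
  exact fill_eq_some_of_iff fun e u => h.specialize_iff htm ht hφ e.1 e.2 u

theorem posYAt_eq_none (hk : 0 < k) (h : IsNcRep P A p) {m t : ℕ} (htm : t ≤ m)
    (hφ : p.phi (m - t) t = 0) :
    posYAt P A.xDiag A.xSet (fun e => A.L e.1 e.2) m t = none := by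
  rw [posYAt, fill_eq_none (⟨0, hk⟩ : Fin k), Option.bind_none]
  rintro u ⟨-, hu⟩
  rw [h.coeff_specialize htm _ _ _ (by simp), hφ, zero_mul] at hu
  exact hu rfl

/-- A pair `(m,t)` recovers `Y` exactly if `φ(m-t,t) ≠ 0` and fails otherwise. So the first pair
that succeeds is right, whichever it is. -/
theorem posY_eq (hk : 0 < k) (h : IsNcRep P A p) {y : Fin k × Fin k → Var k}
    (hy : posY P A.xDiag A.xSet (fun e => A.L e.1 e.2) = some y) : y = fun e => A.Y e.1 e.2 := by
  obtain ⟨m, -, hm⟩ := List.exists_of_findSome?_eq_some hy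
  obtain ⟨t, ht, hmt⟩ := List.exists_of_findSome?_eq_some hm
  rw [List.mem_range] at ht
  by_cases hφ : p.phi (m - (t + 1)) (t + 1) = 0
  · rw [h.posYAt_eq_none hk ht hφ] at hmt
    cases hmt
  · rw [h.posYAt_eq ht (by omega) hφ] at hmt
    exact (Option.some.inj hmt).symm

theorem posY_isSome (h : IsNcRep P A p) {t : ℕ} (ht : 1 ≤ t) (htd : t ≤ famDegree P)
    (hφ : p.phi 0 t ≠ 0) :
    (posY P A.xDiag A.xSet (fun e => A.L e.1 e.2)).isSome := by
  rw [posY, List.findSome?_isSome_iff]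
  refine ⟨t, List.mem_range.2 (by omega), ?_⟩
  rw [List.findSome?_isSome_iff]
  -- The pair `(t,t)` works, since `φ(0,t) ≠ 0`; the inner loop is indexed by the exponent minus
  -- one.
  refine ⟨t - 1, List.mem_range.2 (by omega), ?_⟩
  rw [Nat.sub_add_cancel ht, h.posYAt_eq le_rfl ht (by rwa [Nat.sub_self])]
  rfl

/-- The solution set of NcCoef. -/
theorem ncCoef_eq (h : IsNcRep P A p) :
    ncCoef P A = some {p | p.degree ≤ famDegree P ∧ IsNcRep P A p} := by
  have : ({p | p.degree ≤ famDegree P ∧ IsNcRep P A p} : Set NcPoly).Nonempty :=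
    ⟨_, p.degree_select_le _, h.select⟩
  simp only [ncCoef]
  rw [if_pos this]

theorem afterPartition_eq (h : IsNcRep P A p) {n : ℕ} (hn : 2 ≤ n) (h0 : p.phi n 0 ≠ 0)
    {c : TieBreak k} (hA : A.Normalized c P n (p.phi n 0))
    (hy : posY P A.xDiag A.xSet (fun e => A.L e.1 e.2) = some fun e => A.Y e.1 e.2) :
    afterPartition c P n (p.phi n 0) A.xDiag A.xSet =
      some (A, {p | p.degree ≤ famDegree P ∧ IsNcRep P A p}) := by
  rw [afterPartition, h.parPosX_eq hn h0 hA, Option.bind_some, h.posPol_eq hn h0, Option.bind_some,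
    hy, Option.bind_some, dif_pos ⟨A.var_bij, A.pol_bij⟩]
  exact congrArg (Option.map _) h.ncCoef_eq

theorem eq_of_afterPartition (hk : 0 < k) (h : IsNcRep P A p) {n : ℕ} (hn : 2 ≤ n)
    (h0 : p.phi n 0 ≠ 0) {c : TieBreak k} (hA : A.Normalized c P n (p.phi n 0))
    {A' : Arrangement k} {Sol : Set NcPoly}
    (hr : afterPartition c P n (p.phi n 0) A.xDiag A.xSet = some (A', Sol)) :
    A' = A ∧ Sol = {p | p.degree ≤ famDegree P ∧ IsNcRep P A p} := by
  rcases hy : posY P A.xDiag A.xSet (fun e => A.L e.1 e.2) with _ | y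
  · rw [afterPartition, h.parPosX_eq hn h0 hA, Option.bind_some, h.posPol_eq hn h0,
      Option.bind_some, hy, Option.bind_none] at hr
    cases hr
  · rw [h.posY_eq hk hy] at hy
    rw [h.afterPartition_eq hn h0 hA hy] at hr
    have := Prod.mk.inj (Option.some.inj hr)
    exact ⟨this.1.symm, this.2.symm⟩

/-! ## Normalization -/

/-- The order chosen for the diagonal differs from the given one by a permutation, which conjugation
absorbs. The seed is one of the two mirror entries `x_01` and `x_10`; if it is the wrong one,
transposition corrects it without disturbing the diagonal, at the price of reversing `p`. -/
theorem exists_normalized (h : IsNcRep P A p) {n : ℕ} (hn : 2 ≤ n) (h0 : p.phi n 0 ≠ 0)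
    (c : TieBreak k) : ∃ (A' : Arrangement k) (p' : NcPoly), IsNcRep P A' p' ∧
      (∀ i j, p'.phi i j = p.phi i j) ∧ (∀ t, Separated p t → Separated p' t) ∧
      A'.xDiag = A.xDiag ∧ A'.xSet = A.xSet ∧
      A'.Normalized c P n (p'.phi n 0) := by
  classical
  have himg := c.order_spec _ A.card_xDiag
  have hinj : Function.Injective (c.order A.xDiag) := by
    rw [← Set.injOn_univ, ← Finset.coe_univ]
    refine Finset.card_image_iff.1 ?_
    rw [himg, A.card_xDiag, Finset.card_univ, Fintype.card_fin]
  have hσ : ∀ i, ∃ j, A.X j j = c.order A.xDiag i := by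
    intro i
    have : c.order A.xDiag i ∈ A.xDiag := by
      have := Finset.mem_image_of_mem (c.order A.xDiag) (Finset.mem_univ i)
      rwa [himg] at this
    obtain ⟨j, -, hj⟩ := Finset.mem_image.1 this
    exact ⟨j, hj⟩
  choose f hf using hσ
  have hfi : Function.Injective f := fun i j hij => hinj (by rw [← hf, ← hf, hij])
  let σ : Equiv.Perm (Fin k) := Equiv.ofBijective f (Finite.injective_iff_bijective.1 hfi)
  have hB := h.conj σ
  have hord : c.order (A.conj σ).xDiag = fun i => (A.conj σ).X i i := by
    rw [A.xDiag_conj]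
    funext i
    exact (hf i).symm
  by_cases hn' : (A.conj σ).Normalized c P n (p.phi n 0)
  · exact ⟨_, p, hB, fun _ _ => rfl, fun _ => id, A.xDiag_conj σ, A.xSet_conj σ, hn'⟩
  -- The lists from which the seed is picked depend on the family and on the diagonal and variables
  -- of `X`, all unchanged by transposition; so the same pick is now in the right place.
  · refine ⟨_, p.reverse, hB.transpose, p.phi_reverse, fun _ => Separated.reverse,
      by rw [Arrangement.xDiag_transpose, A.xDiag_conj],
      by rw [Arrangement.xSet_transpose, A.xSet_conj], ?_⟩
    rw [NcPoly.phi_reverse]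
    refine ⟨hord, fun i j hi hj => ?_⟩
    have hne : ∀ i j : Fin k, i.val = 0 → j.val = 1 → i ≠ j := by
      rintro i j hi hj rfl
      omega
    have hpick : ∀ i j : Fin k, i.val = 0 → j.val = 1 → _ := fun i j hi hj =>
      (hB.mem_rowCol_inter hn h0 (hne i j hi hj) _).1 (c.pick_mem _
        ⟨(A.conj σ).X i j, (hB.mem_rowCol_inter hn h0 (hne i j hi hj) _).2 (Or.inl rfl)⟩)
    rw [Arrangement.xDiag_transpose, Arrangement.xSet_transpose]
    rcases hpick i j hi hj with h1 | h1
    · refine absurd ⟨hord, fun i' j' hi' hj' => ?_⟩ hn'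
      obtain rfl : i = i' := Fin.ext (hi.trans hi'.symm)
      obtain rfl : j = j' := Fin.ext (hj.trans hj'.symm)
      exact h1
    · exact h1

end IsNcRep

namespace IsNcRep

/-! ## The class `𝒲` depends only on the family and the arrangement -/

/-- After the substitution `X = I`, `φ(i,j)` is the coefficient of `y_00^j` in the polynomial at
`(0,0)`, taken in degree `i + j`. -/
theorem phi_eq (hk : 0 < k) (h : IsNcRep P A p) (h' : IsNcRep P A p') (i j : ℕ) : p.phi i j = p'.phi i j := by
  have key : ∀ {p}, IsNcRep P A p → MvPolynomial.coeff (Finsupp.single (A.Y ⟨0, hk⟩ ⟨0, hk⟩) j)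
      (specialize P A.xDiag A.xSet (i + j) (A.L ⟨0, hk⟩ ⟨0, hk⟩)) = p.phi i j := by
    intro p h
    rw [h.coeff_specialize (Nat.le_add_left j i) _ _ _ (by simp), ← A.var_one,
      wordCoeff_pow A.generic]
    simp
  rw [← key h, ← key h']

/-- The monomial `x_00^(n-1) y_01` at `(0,1)` shows this coefficient. Two indices are needed: for `k
= 1` the matrices commute and the order of letters is invisible. -/
theorem phiEnd_eq (hk : 2 ≤ k) (h : IsNcRep P A p) (h' : IsNcRep P A p') {n : ℕ} (hn : 2 ≤ n) :
    p.phiEnd (n - 1) 1 1 = p'.phiEnd (n - 1) 1 1 := by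
  have hne : (⟨0, by omega⟩ : Fin k) ≠ ⟨1, by omega⟩ := by simp
  have key := h.two_offdiag hn ⟨0, by omega⟩ ⟨1, by omega⟩ ⟨0, by omega⟩ 1 hne
  rw [h'.two_offdiag hn _ _ _ _ hne, if_pos ⟨rfl, rfl⟩, if_pos rfl, if_pos ⟨rfl, rfl⟩,
    if_pos rfl] at key
  rw [p.phiEnd_one, p'.phiEnd_one]
  exact key.symm

theorem phiStart_eq (hk : 2 ≤ k) (h : IsNcRep P A p) (h' : IsNcRep P A p') {n : ℕ} (hn : 2 ≤ n) :
    p.phiStart 1 (n - 1) 1 = p'.phiStart 1 (n - 1) 1 := by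
  have := h.transpose.phiEnd_eq hk h'.transpose hn
  rwa [NcPoly.phiEnd_reverse, NcPoly.phiEnd_reverse] at this

theorem separated (hk : 2 ≤ k) (h : IsNcRep P A p) (h' : IsNcRep P A p') {t : ℕ} (ht : 2 ≤ t)
    (hs : Separated p t) : Separated p' t := by
  have hk0 : 0 < k := by omega
  have e1 := h.swap.phiEnd_eq hk h'.swap ht
  have e2 := h.swap.phiStart_eq hk h'.swap ht
  simp only [NcPoly.phiEnd_swapLetters, NcPoly.phiStart_swapLetters, Equiv.swap_apply_right]
    at e1 e2
  rw [Separated, h.phi_eq hk0 h' t 0, h.phi_eq hk0 h' 0 t,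
    h.phi_eq hk0 h' (t - 1) 1, h.phi_eq hk0 h' 1 (t - 1),
    h.phiEnd_eq hk h' ht, h.phiStart_eq hk h' ht, e1, e2] at hs
  exact hs

/-! ## Success of the algorithms -/

/-- The monomial `x_00^n` is present in the family. Hence the degree bound of the search and of
NcCoef loses nothing relevant to `𝒲`. -/
theorem le_famDegree (hk : 0 < k) (h : IsNcRep P A p) {n : ℕ} (hn : 2 ≤ n) (h0 : p.phi n 0 ≠ 0) :
    n ≤ famDegree P := by
  by_contra hlt
  refine h0 ?_
  have h1 := h.one_diag hn 0 ⟨0, hk⟩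
  rw [p.phi_zero_right]
  refine h1.symm.trans (MvPolynomial.coeff_eq_zero_of_totalDegree_lt ?_)
  have h2 : (P (A.L ⟨0, hk⟩ ⟨0, hk⟩)).totalDegree ≤ famDegree P :=
    Finset.le_sup (f := fun q => (P q).totalDegree) (Finset.mem_univ _)
  have h3 : ((Finsupp.single (A.var 0 ⟨0, hk⟩ ⟨0, hk⟩) n).sum fun _ e => e) = n :=
    Finsupp.sum_single_index rfl
  exact (lt_of_le_of_lt h2 (not_le.1 hlt)).trans_eq h3.symm

/-- The degree `n` used for the reconstruction and the degree `t` that witnesses membership in `𝒲`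
are independent: once the arrangement is recovered, the truncated polynomial is a solution and
remains separated at `t`. -/
theorem nonempty_of_afterPartition (hk : 0 < k) (h : IsNcRep P A p) {n t : ℕ} (hn : 2 ≤ n)
    (ht : 2 ≤ t) (hs : Separated p t) (h0 : p.phi n 0 ≠ 0) {c : TieBreak k}
    {A' : Arrangement k} {Sol : Set NcPoly}
    (hr : afterPartition c P n (p.phi n 0) A.xDiag A.xSet = some (A', Sol)) :
    (Sol ∩ classW).Nonempty := by
  obtain ⟨B, p', hB, hφ, hs', hD, hS, hN⟩ := h.exists_normalized hn h0 c
  rw [← hφ, ← hD, ← hS] at hr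
  rw [← hφ] at h0
  obtain ⟨-, rfl⟩ := hB.eq_of_afterPartition hk hn h0 hN hr
  exact ⟨_, ⟨p'.degree_select_le _, hB.select⟩, (mem_classW_iff _).2
    ⟨t, ht, (hs' t hs).select ht (hB.le_famDegree hk ht (hs' t hs).1)⟩⟩

/-- The coefficient `a` belongs to the diagonal of `X` or of `Y`; the second case is reduced to the
first by interchanging the letters. -/
theorem nonempty_of_success (hk : 0 < k) (h : IsNcRep P A p) {n t : ℕ} (hn : 2 ≤ n)
    (ht : 2 ≤ t) (hs : Separated p t) {a : ℝ} (ha : DiagOK P n a)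
    {T : Family k → ℕ → ℝ → Finset (Var k) → Var k → Prop}
    (hT : T = Par1Test ∨ T = Par2Test) {c : TieBreak k} {S : Finset (Var k)}
    {A' : Arrangement k} {Sol : Set NcPoly}
    (hS : partition (diagVars P n a) (T P n a (diagVars P n a)) = some S)
    (hr : afterPartition c P n a (diagVars P n a) S = some (A', Sol)) :
    (Sol ∩ classW).Nonempty := by
  have key : ∀ {A : Arrangement k} {p : NcPoly}, IsNcRep P A p → Separated p t →
      p.phi n 0 = a → p.phi 0 n ≠ a → a ≠ 0 → (Sol ∩ classW).Nonempty := by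
    rintro A p h hs rfl h1 h0
    rw [h.diagVars_eq hn h0 h1] at hS hr
    obtain rfl : S = A.xSet := by
      refine partition_eq_xSet ?_ hS
      rcases hT with rfl | rfl
      · exact Or.inl fun b c hbc => h.par1Test_X hn h0 hbc
      · exact Or.inr fun b c => h.not_par2Test_Y hn h0 b c
    exact h.nonempty_of_afterPartition hk hn ht hs h0 hr
  obtain ⟨h0, ⟨h1, h2⟩ | ⟨h1, h2⟩⟩ := h.diagOK_cases hk hn ha
  · exact key h hs h1 h2 h0
  · exact key h.swap hs.swapLetters (by rwa [NcPoly.phi_swapLetters])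
      (by rwa [NcPoly.phi_swapLetters]) h0

theorem nonempty_of_run (hk : 0 < k) (h : IsNcRep P A p) {t : ℕ} (ht : 2 ≤ t)
    (hs : Separated p t) {T : Family k → ℕ → ℝ → Finset (Var k) → Var k → Prop}
    (hT : T = Par1Test ∨ T = Par2Test) {c : TieBreak k}
    {A' : Arrangement k} {Sol : Set NcPoly} (hr : run T c P = some (A', Sol)) :
    (Sol ∩ classW).Nonempty := by
  obtain ⟨n, -, hn⟩ := List.exists_of_findSome?_eq_some hr
  obtain ⟨a, -, ha⟩ := List.exists_of_findSome?_eq_some hn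
  split_ifs at ha with hc
  obtain ⟨S, hS, hA⟩ := Option.bind_eq_some_iff.1 ha
  exact h.nonempty_of_success hk hc.1 ht hs hc.2 hT hS hA

/-- It suffices that the pair `(n, φ(n,0))` would succeed; an earlier pair may be the one whose
result is returned. -/
theorem run_isSome (hk : 0 < k) (h : IsNcRep P A p) {n : ℕ} (hn : 2 ≤ n) (h0 : p.phi n 0 ≠ 0)
    (h1 : p.phi 0 n ≠ 0) (h01 : p.phi n 0 ≠ p.phi 0 n)
    {T : Family k → ℕ → ℝ → Finset (Var k) → Var k → Prop}
    (hT : ∀ b c, b ≠ c → T P n (p.phi n 0) A.xDiag (A.X b c))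
    (hT' : ∀ b c, ¬ T P n (p.phi n 0) A.xDiag (A.Y b c)) (c : TieBreak k) :
    (run T c P).isSome := by
  have hd := h.le_famDegree hk hn h0
  rw [run, List.findSome?_isSome_iff]
  refine ⟨n, List.mem_range.2 (by omega), ?_⟩
  rw [List.findSome?_isSome_iff]
  refine ⟨p.phi n 0, ?_, ?_⟩
  · rw [Finset.mem_toList, oneCoeffs, Finset.mem_erase, Finset.mem_image]
    refine ⟨h0, (A.L ⟨0, hk⟩ ⟨0, hk⟩, A.var 0 ⟨0, hk⟩ ⟨0, hk⟩), Finset.mem_univ _, ?_⟩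
    rw [h.one_diag hn, p.phi_zero_right]
    rfl
  · rw [if_pos ⟨hn, h.diagOK hn h0 h1 h01⟩, h.diagVars_eq hn h0 h01.symm,
      partition_of_test hT hT', Option.bind_some]
    obtain ⟨B, p', hB, hφ, -, hD, hS, hN⟩ := h.exists_normalized hn h0 c
    obtain ⟨y, hy⟩ := Option.isSome_iff_exists.1
      (hB.posY_isSome (by omega : 1 ≤ n) hd (by rwa [hφ]))
    have hy' := hy
    rw [hB.posY_eq hk hy] at hy'
    rw [← hφ, ← hD, ← hS, hB.afterPartition_eq hn (by rwa [hφ]) hN hy']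
    rfl

/-- Conditions 1 and 2 are served by Alg.1, conditions 3 to 6 by Alg.2. Those formulated with
`φ(0,t)` are applied after interchanging the letters. -/
theorem alg_isSome (hk : 0 < k) (h : IsNcRep P A p) {t : ℕ} (ht : 2 ≤ t) (hs : Separated p t)
    (c : TieBreak k) : (alg1 c P).isSome ∨ (alg2 c P).isSome := by
  have key1 : ∀ {A : Arrangement k} {p : NcPoly}, IsNcRep P A p → Separated p t →
      (t : ℝ) * p.phi t 0 ≠ p.phi (t - 1) 1 → (alg1 c P).isSome := fun h hs hc =>
    h.run_isSome hk ht hs.1 hs.2.1 hs.2.2.1 (fun _ _ hbc => h.par1Test_X ht hs.1 hbc)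
      (fun b c => h.not_par1Test_Y ht hs.1 hs.2.1 hc b c) c
  have key2 : ∀ {A : Arrangement k} {p : NcPoly}, IsNcRep P A p → Separated p t →
      (p.phi t 0 ≠ p.phiEnd (t - 1) 1 1 ∨ p.phi t 0 ≠ p.phiStart 1 (t - 1) 1) →
      (alg2 c P).isSome := fun h hs hc =>
    h.run_isSome hk ht hs.1 hs.2.1 hs.2.2.1 (fun _ _ hbc => h.par2Test_X ht hs.1 hc hbc)
      (fun b c => h.not_par2Test_Y ht hs.1 b c) c
  rcases hs.2.2.2 with hc | hc | ⟨-, hc⟩ | ⟨-, hc⟩ | ⟨-, hc⟩ | ⟨-, hc⟩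
  · exact Or.inl (key1 h hs hc)
  · refine Or.inl (key1 h.swap hs.swapLetters ?_)
    rwa [NcPoly.phi_swapLetters, NcPoly.phi_swapLetters]
  · exact Or.inr (key2 h hs (Or.inl hc))
  · exact Or.inr (key2 h hs (Or.inr hc))
  · refine Or.inr (key2 h.swap hs.swapLetters (Or.inl ?_))
    rwa [NcPoly.phi_swapLetters, NcPoly.phiEnd_swapLetters, Equiv.swap_apply_right]
  · refine Or.inr (key2 h.swap hs.swapLetters (Or.inr ?_))
    rwa [NcPoly.phi_swapLetters, NcPoly.phiStart_swapLetters, Equiv.swap_apply_right]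

end IsNcRep

/-! ### Soundness of the returned solutions, and the decision theorem -/

theorem isNcRep_of_run {T : Family k → ℕ → ℝ → Finset (Var k) → Var k → Prop} {c : TieBreak k}
    {Sol : Set NcPoly} (hr : run T c P = some (A, Sol)) : ∀ p ∈ Sol, IsNcRep P A p := by
  obtain ⟨n, -, hn⟩ := List.exists_of_findSome?_eq_some hr
  obtain ⟨a, -, ha⟩ := List.exists_of_findSome?_eq_some hn
  split_ifs at ha with hc
  obtain ⟨S, -, hA⟩ := Option.bind_eq_some_iff.1 ha
  obtain ⟨x, -, hA⟩ := Option.bind_eq_some_iff.1 hA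
  obtain ⟨lam, -, hA⟩ := Option.bind_eq_some_iff.1 hA
  obtain ⟨y, -, hA⟩ := Option.bind_eq_some_iff.1 hA
  split_ifs at hA with hb
  obtain ⟨Sol', hSol, hA⟩ := Option.map_eq_some_iff.1 hA
  obtain ⟨rfl, rfl⟩ := Prod.mk.inj hA
  simp only [ncCoef, Option.ite_none_right_eq_some, Option.some.injEq] at hSol
  obtain ⟨-, rfl⟩ := hSol
  exact fun p hp => hp.2

end Representations

theorem theorem1p4 (k : ℕ) (hk : 0 < k) (P : Family k) (c : OneLetter.TieBreak k) :
    (HasNcRepIn P classW ↔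
      ∃ (A : Arrangement k) (Sol : Set NcPoly),
        (OneLetter.alg1 c P = some (A, Sol) ∨ OneLetter.alg2 c P = some (A, Sol)) ∧
        (Sol ∩ classW).Nonempty) ∧
    (∀ (A : Arrangement k) (Sol : Set NcPoly),
      (OneLetter.alg1 c P = some (A, Sol) ∨ OneLetter.alg2 c P = some (A, Sol)) →
        (∀ p ∈ Sol, IsNcRep P A p) ∧
        (2 ≤ k → (Sol ∩ classW).Nonempty → Sol ⊆ classW)) := by
  have hrep : ∀ (A : Arrangement k) (Sol : Set NcPoly),
      (OneLetter.alg1 c P = some (A, Sol) ∨ OneLetter.alg2 c P = some (A, Sol)) →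
        ∀ p ∈ Sol, IsNcRep P A p := fun A Sol h => h.elim isNcRep_of_run isNcRep_of_run
  refine ⟨⟨?_, ?_⟩, fun A Sol h => ⟨hrep A Sol h, ?_⟩⟩
  · rintro ⟨A, p, h, hp⟩
    obtain ⟨t, ht, hs⟩ := (mem_classW_iff p).1 hp
    -- The returned arrangement need not be `A`; `nonempty_of_run` provides a solution in `𝒲` for
    -- whichever arrangement it is.
    rcases h.alg_isSome hk ht hs c with h1 | h1 <;>
      obtain ⟨⟨A', Sol⟩, h2⟩ := Option.isSome_iff_exists.1 h1
    · exact ⟨A', Sol, Or.inl h2, h.nonempty_of_run hk ht hs (Or.inl rfl) h2⟩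
    · exact ⟨A', Sol, Or.inr h2, h.nonempty_of_run hk ht hs (Or.inr rfl) h2⟩
  · rintro ⟨A, Sol, h, p, hp, hW⟩
    exact ⟨A, p, hrep A Sol h p hp, hW⟩
  · rintro hk2 ⟨p, hp, hW⟩ p' hp'
    obtain ⟨t, ht, hs⟩ := (mem_classW_iff p).1 hW
    exact (mem_classW_iff p').2
      ⟨t, ht, (hrep A Sol h p hp).separated hk2 (hrep A Sol h p' hp') ht hs⟩
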